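/- **Setting.** An episodic POMDP has horizon $H\ge 1$, a state space $\mathcal S$ with fixed initial state $s_0$, a finite action set $\mathcal A$ with $|\mathcal A|=A\ge 1$, an observation space $\mathcal O$, and, for $0\le h<H$, transition laws $\mathbb T_h(\cdot\mid s,a)$ on $\mathcal S$, emission laws $\mathbb O_h(\cdot\mid s)$ on $\mathcal O$ and reward laws $\mathbb Y_h(\cdot\mid s,a)$ on $[0,1]$ with means $r_h(s,a)$. At step $h$ the agent sees $o_h\sim\mathbb O_h(\cdot\mid s_h)$, plays $a_h$, receives a reward drawn from $\mathbb Y_h(\cdot\mid s_h,a_h)$, and $s_{h+1}\sim\mathbb T_h(\cdot\mid s_h,a_h)$; the states are hidden. Let $\psi:\mathcal O\to\mathbb R^d$ be a known feature with $\|\psi(o)\|\le 1$ for all $o$, and $\phi:\mathcal S\to\mathbb R^{d_s}$, $d_s\ge 1$. Assume: 1. (Left-invertible conditional embedding) for every $h<H$ there is a left-invertible matrix $G_h\in\mathbb R^{d\times d_s}$ with $\mathbb E_{o\sim\mathbb O_h(s)}[\psi(o)]=G_h\phi(s)$ for all $s$; 2. (Deterministic latent transitions) $\mathbb T_h(\cdot\mid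 s,a)$ is the Dirac measure at $p_h(s,a)$; 3. (Linear $Q^\star$) with $Q^\star_H=0$, $V^\star_h(s)=\max_a Q^\star_h(s,a)$ and $Q^\star_h(s,a)=r_h(s,a)+V^\star_{h+1}(p_h(s,a))$, one has $Q^\star_h(s,a)=\langle w^\star_{a;h},\phi(s)\rangle$ for all $s$, with $\|w^\star_{a;h}\|\le W$, for all $h<H$ and $a\in\mathcal A$; 4. (Gap) whenever $\mathrm{gap}_h(s,a)=V^\star_h(s)-Q^\star_h(s,a)$ is positive, it is at least $\Delta$, where $\Delta>0$. Let $\Theta=W/\min_{h<H}\eta(G_h)$, where $\eta$ denotes the smallest singular value, and assume $\Theta\ge 1$ and $\Delta\le\Theta$. (The first holds after enlarging $W$ if necessary; the second is automatic as soon as some gap is positive.) Let $0<\delta\le 1/2$. **Algorithm EQDP** (parameters $\lambda>0$, $M\ge 1$, $\varepsilon>0$). It keeps lists $\mathcal D_h$ of vectors of $\mathbb R^d$ and $\mathcal D_{a;h}$ of pairs $(x,y)\in\mathbb R^d\times\mathbb R$, all initially empty. Put $\Sigma_h=\lambda I+\sum_{x\in\mathcal D_h}xx^\top$, $\|x\|_{\Sigma_h^{-1}}=(x^\top\Sigma_h^{-1}x)^{1/2}$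 and $\hat\theta_{a;h}=\Sigma_h^{-1}\sum_{(x,y)\in\mathcal D_{a;h}}yx$, always for the current lists. For an action sequence $a_{0:h-1}$, $\hat x_h(a_{0:h-1})$ is the mean of $\psi(o_h)$ over $M$ fresh episodes in which $a_{0:h-1}$ is executed, and $\hat r_h(a_{0:h-1},a)$ is the mean reward at step $h$ over $M$ fresh episodes in which $a_{0:h-1},a$ is executed. Ties in every $\arg\max$ are broken arbitrarily. *Explore*$(a_{0:h-1},x)$: for each $a\in\mathcal A$ in turn, compute $y_a=\hat r_h(a_{0:h-1},a)+\text{Compute-}V^\star(h+1;a_{0:h-1},a)$ and append $(x,y_a)$ to $\mathcal D_{a;h}$; after this loop append $x$ to $\mathcal D_h$. *Compute-$V^\star$*$(h;a_{0:h-1})$: if $h=H$, return $0$. If $h=H-1$, return $\max_a\hat r_h(a_{0:h-1},a)$. Otherwise form $x=\hat x_h(a_{0:h-1})$. If $\|x\|_{\Sigma_h^{-1}}\le\varepsilon$, let $a_h\in\arg\max_a\langle\hat\theta_{a;h},x\rangle$ and return $\hat r_h(a_{0:h-1},a_h)+\text{Compute-}V^\star(h+1;a_{0:h-1},a_h)$;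 else run Explore$(a_{0:h-1},x)$ and return $\max_a y_a$. *Main loop*: repeat the following. For $h=0,\dots,H-1$ form $\hat x_h(a_{0:h-1})$ and choose $a_h\in\arg\max_a\langle\hat\theta_{a;h},\hat x_h(a_{0:h-1})\rangle$. If $\|\hat x_h(a_{0:h-1})\|_{\Sigma_h^{-1}}\le\varepsilon$ for all $h$, return $a_{0:H-1}$ and stop; else run Explore$(a_{0:h-1},\hat x_h(a_{0:h-1}))$ for the smallest $h$ that violates this. **Theorem (Sample Complexity).** There are universal constants $C>0$ and $m\in\mathbb N$ such that, for suitable $\lambda,M,\varepsilon$ that depend only on $H,d,A,\Theta,\Delta,\delta$, the following holds for every POMDP as above. With probability at least $1-\delta$, EQDP terminates and returns an optimal action sequence $a^\star_{0:H-1}$, that is, one whose expected total reward is maximal among all history-dependent policies, after using at most $$C\,L^m\,H^5\,\Theta^5\,d^2A^2\,\Delta^{-5}\ln(1/\delta),\qquad L=\ln\bigl(2+H+d+A+\Theta+1/\Delta+\ln(1/\delta)\bigr),$$ samples, where every executed episode is counted as $H$ samples. In other words, the sample complexity is $\tilde O\bigl(H^5\Theta^5d^2A^2\Delta^{-5}\ln(1/\delta)\bigr)$.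 -/

import Mathlib

open MeasureTheory ProbabilityTheory
open scoped ENNReal

namespace EQDP

/-! ## Partially observable Markov decision processes -/

/-- An episodic POMDP with states `S`, actions `A` and observations `O`.  All families are indexed
by `h : ℕ`; with a horizon `H`, only the members with `h < H` play a role. -/
structure POMDP (S A O : Type*) [MeasurableSpace S] [MeasurableSpace O] where
  /-- the latent transition `T_h(· | s, a)` -/
  trans : ℕ → A → Kernel S S
  /-- the emission distribution `O_h(· | s)` -/
  emit : ℕ → Kernel S O
  /-- the reward distribution `Y_h(· | s, a)` -/
  rew : ℕ → A → Kernel S ℝ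
  /-- the initial state -/
  init : S
  trans_markov : ∀ h a, IsMarkovKernel (trans h a)
  emit_markov : ∀ h, IsMarkovKernel (emit h)
  rew_markov : ∀ h a, IsMarkovKernel (rew h a)
  /-- rewards lie in `[0, 1]` -/
  rew_mem : ∀ h a s, ∀ᵐ y ∂(rew h a s), y ∈ Set.Icc (0 : ℝ) 1

namespace POMDP

variable {S A O : Type*} [MeasurableSpace S] [MeasurableSpace O]

/-- The mean reward `r_h(s, a)`. -/
noncomputable def meanReward (P : POMDP S A O) (h : ℕ) (s : S) (a : A) : ℝ :=
  ∫ y, y ∂(P.rew h a s)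

/-- The law of the latent state after executing a list of actions from time `h` on, when the law of
the state at time `h` is `μ`. -/
noncomputable def stateLawFrom (P : POMDP S A O) : ℕ → Measure S → List A → Measure S
  | _, μ, [] => μ
  | h, μ, a :: l => stateLawFrom P (h + 1) (μ.bind (P.trans h a)) l

/-- The law of the latent state at time `h` after executing the actions `l = a_{0:h-1}` in a new
episode (here `h = l.length`). -/
noncomputable def stateLaw (P : POMDP S A O) (l : List A) : Measure S :=
  P.stateLawFrom 0 (Measure.dirac P.init) l

/-- The law of the observation `o_h` after executing `l = a_{0:h-1}` in a new episode. -/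
noncomputable def obsLaw (P : POMDP S A O) (l : List A) : Measure O :=
  (P.stateLaw l).bind (P.emit l.length)

/-- The law of the reward at time `h` after executing `l = a_{0:h-1}` and then `a` in a new
episode. -/
noncomputable def rewLaw (P : POMDP S A O) (l : List A) (a : A) : Measure ℝ :=
  (P.stateLaw l).bind (P.rew l.length a)

/-! ### Policies and optimal action sequences -/

/-- A history-dependent, possibly randomized policy.  It sees the past triples
`(o_k, a_k, r_k)`, `k < h`, and the current observation `o_h`; the time `h` is the length of the
history. -/
abbrev Policy (A O : Type*) := List (O × A × ℝ) → O → PMF A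

/-- The expected sum of the next `n` rewards under the policy `π`, starting at time `h` in the
latent state `s` with the given observable history.  (Rewards are nonnegative, so the expectations
are written as integrals with values in `[0, ∞]`.) -/
noncomputable def policyValueFrom [Fintype A] (P : POMDP S A O) (π : Policy A O) :
    ℕ → ℕ → S → List (O × A × ℝ) → ℝ≥0∞
  | 0, _, _, _ => 0
  | n + 1, h, s, hist =>
      ∫⁻ o, ∑ a : A, π hist o a *
        ∫⁻ y, (ENNReal.ofReal y +
          ∫⁻ s', policyValueFrom P π n (h + 1) s' (hist ++ [(o, a, y)]) ∂(P.trans h a s))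
        ∂(P.rew h a s) ∂(P.emit h s)

/-- The expected total reward `E_π[∑_{h < H} r_h]` of a policy in an episode of length `H`. -/
noncomputable def policyValue [Fintype A] (P : POMDP S A O) (H : ℕ) (π : Policy A O) : ℝ≥0∞ :=
  P.policyValueFrom π H 0 P.init []

/-- The policy that plays the fixed action sequence `l` (and an arbitrary action after its end). -/
noncomputable def openLoop [Nonempty A] (l : List A) : Policy A O :=
  fun hist _ => PMF.pure ((l[hist.length]?).getD (Classical.arbitrary A))

/-- `l = a_{0:H-1}` is an optimal action sequence: as a policy it is a maximizer of the expected
total reward among all history-dependent policies. -/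
def IsOptimalSeq [Fintype A] [Nonempty A] (P : POMDP S A O) (H : ℕ) (l : List A) : Prop :=
  l.length = H ∧ ∀ π : Policy A O, P.policyValue H π ≤ P.policyValue H (openLoop l)

/-! ### Optimal value functions under deterministic transitions -/

/-- The optimal value with `n` steps to go at time `h`, for the deterministic transition map `p`. -/
noncomputable def valueToGo [Fintype A] [Nonempty A] (P : POMDP S A O) (p : ℕ → S → A → S) :
    ℕ → ℕ → S → ℝ
  | 0, _, _ => 0
  | n + 1, h, s =>
      Finset.univ.sup' Finset.univ_nonempty
        (fun a : A => P.meanReward h s a + valueToGo P p n (h + 1) (p h s a))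

/-- `Q*_h(s, a) = r_h(s, a) + max_{a'} Q*_{h+1}(p_h(s, a), a')` for `h < H`, with `Q*_H = 0`. -/
noncomputable def Qstar [Fintype A] [Nonempty A] (P : POMDP S A O) (p : ℕ → S → A → S)
    (H h : ℕ) (s : S) (a : A) : ℝ :=
  if h < H then P.meanReward h s a + P.valueToGo p (H - (h + 1)) (h + 1) (p h s a) else 0

/-- `V*_h(s) = max_a Q*_h(s, a)`. -/
noncomputable def Vstar [Fintype A] [Nonempty A] (P : POMDP S A O) (p : ℕ → S → A → S)
    (H h : ℕ) (s : S) : ℝ :=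
  Finset.univ.sup' Finset.univ_nonempty (fun a : A => P.Qstar p H h s a)

/-- `gap_h(s, a) = V*_h(s) - Q*_h(s, a)`. -/
noncomputable def gap [Fintype A] [Nonempty A] (P : POMDP S A O) (p : ℕ → S → A → S)
    (H h : ℕ) (s : S) (a : A) : ℝ :=
  P.Vstar p H h s - P.Qstar p H h s a

end POMDP

/-- The smallest singular value of a `d × k` matrix (the singular values are listed in decreasing
order, starting from index `0`). -/
noncomputable def smallestSingularValue {d k : ℕ} (G : Matrix (Fin d) (Fin k) ℝ) : ℝ :=
  (Matrix.toEuclideanLin G).singularValues (min d k - 1)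

/-! ## Programs that interact with an unknown POMDP -/

/-- A program that interacts with an environment by running episodes and finally returns an element
of `α`.  Everything it does depends on the environment only through the samples it has received. -/
inductive Prog (A O α : Type*)
  /-- stop and return a value -/
  | ret (x : α) : Prog A O α
  /-- execute `a_{0:h-1}` in a new episode, read the observation `o_h`, and continue -/
  | observe (l : List A) (k : O → Prog A O α) : Prog A O α
  /-- execute `a_{0:h-1}` and then `a` in a new episode, read the reward at time `h`, continue -/
  | reward (l : List A) (a : A) (k : ℝ → Prog A O α) : Prog A O α

namespace Prog

variable {S A O : Type*} [MeasurableSpace S] [MeasurableSpace O]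

/-- Sequential composition. -/
def bind {α β : Type*} : Prog A O α → (α → Prog A O β) → Prog A O β
  | ret x, f => f x
  | observe l k, f => observe l (fun o => (k o).bind f)
  | reward l a k, f => reward l a (fun y => (k y).bind f)

/-- Run a program `n` times in a row and list the results. -/
def replicate {α : Type*} : ℕ → Prog A O α → Prog A O (List α)
  | 0, _ => ret []
  | n + 1, q => q.bind fun x => (replicate n q).bind fun xs => ret (x :: xs)

/-- The expectation of `f (result) (number of episodes)` for a program that is run on the POMDP `P`
when `n` episodes have been executed before. -/
noncomputable def expect {α : Type*} (P : POMDP S A O) (f : α → ℕ → ℝ≥0∞) :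
    Prog A O α → ℕ → ℝ≥0∞
  | ret x, n => f x n
  | observe l k, n => ∫⁻ o, expect P f (k o) (n + 1) ∂(P.obsLaw l)
  | reward l a k, n => ∫⁻ y, expect P f (k y) (n + 1) ∂(P.rewLaw l a)

open Classical in
/-- The probability that the program, run on `P`, stops with a result `x` after a number `n` of
episodes such that `E x n` holds. -/
noncomputable def prob {α : Type*} (P : POMDP S A O) (q : Prog A O α) (E : α → ℕ → Prop) : ℝ≥0∞ :=
  q.expect P (fun x n => if E x n then 1 else 0) 0

end Prog

/-! ## The algorithm -/

/-- The inputs of the algorithm: horizon, observation feature, the parameters `M`, `ε`, `λ`, and the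
rule that selects a maximizer in `argmax_a`. -/
structure Params (A O : Type*) (d : ℕ) where
  H : ℕ
  ψ : O → EuclideanSpace ℝ (Fin d)
  M : ℕ
  ε : ℝ
  lam : ℝ
  argmax : (A → ℝ) → A

/-- The data sets: `feats h` is `D_h` and `pairs a h` is `D_{a;h}`. -/
structure Data (A : Type*) (d : ℕ) where
  feats : ℕ → List (EuclideanSpace ℝ (Fin d))
  pairs : A → ℕ → List (EuclideanSpace ℝ (Fin d) × ℝ)

namespace Data

variable {A : Type*} {d : ℕ}

/-- All data sets are empty. -/
def empty : Data A d := ⟨fun _ => [], fun _ _ => []⟩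

/-- Add `x` to `D_h`. -/
def addFeat (D : Data A d) (h : ℕ) (x : EuclideanSpace ℝ (Fin d)) : Data A d :=
  { D with feats := Function.update D.feats h (D.feats h ++ [x]) }

open Classical in
/-- Add `(x, y)` to `D_{a;h}`. -/
noncomputable def addPair (D : Data A d) (a : A) (h : ℕ) (x : EuclideanSpace ℝ (Fin d)) (y : ℝ) :
    Data A d :=
  { D with pairs := fun b k =>
      if b = a ∧ k = h then D.pairs b k ++ [(x, y)] else D.pairs b k }

/-- `Σ_h = ∑_{x ∈ D_h} x xᵀ + λ I`. -/
noncomputable def Sig (D : Data A d) (lam : ℝ) (h : ℕ) : Matrix (Fin d) (Fin d) ℝ :=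
  ((D.feats h).map fun x => Matrix.vecMulVec x.ofLp x.ofLp).sum + lam • 1

/-- `‖x‖_{Σ_h⁻¹}`, the square root of `xᵀ Σ_h⁻¹ x`. -/
noncomputable def invNorm (D : Data A d) (lam : ℝ) (h : ℕ) (x : EuclideanSpace ℝ (Fin d)) : ℝ :=
  Real.sqrt (x.ofLp ⬝ᵥ ((D.Sig lam h)⁻¹.mulVec x.ofLp))

/-- The ridge regression estimator: `Σ_h⁻¹ ∑ x y` over the pairs `(x, y)` in `D_{a;h}`. -/
noncomputable def thetaHat (D : Data A d) (lam : ℝ) (a : A) (h : ℕ) : Fin d → ℝ :=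
  (D.Sig lam h)⁻¹.mulVec ((D.pairs a h).map fun z => z.2 • z.1.ofLp).sum

end Data

section Algorithm

variable {A O : Type*} {d : ℕ}

/-- Collect `M` observations after `l = a_{0:h-1}` and return the mean of their features. -/
noncomputable def estFeature (c : Params A O d) (l : List A) :
    Prog A O (EuclideanSpace ℝ (Fin d)) :=
  (Prog.replicate c.M (Prog.observe l Prog.ret)).bind fun os =>
    Prog.ret ((c.M : ℝ)⁻¹ • (os.map c.ψ).sum)

/-- Collect `M` rewards of the action `a` after `l = a_{0:h-1}` and return their mean. -/
noncomputable def estReward (c : Params A O d) (l : List A) (a : A) : Prog A O ℝ :=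
  (Prog.replicate c.M (Prog.reward l a Prog.ret)).bind fun ys =>
    Prog.ret ((c.M : ℝ)⁻¹ * ys.sum)

/-- `argmax_a ⟨θ̂_{a;h}, x⟩`. -/
noncomputable def greedy (c : Params A O d) (D : Data A d) (h : ℕ)
    (x : EuclideanSpace ℝ (Fin d)) : A :=
  c.argmax fun a => D.thetaHat c.lam a h ⬝ᵥ x.ofLp

open Classical in
/-- Estimate the rewards, after `l`, of all actions in a list. -/
noncomputable def rewardLoop (c : Params A O d) (l : List A) :
    List A → (A → ℝ) → Prog A O (A → ℝ)
  | [], y => Prog.ret y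
  | a :: as, y => (estReward c l a).bind fun r => rewardLoop c l as (Function.update y a r)

open Classical in
/-- The loop over the actions in a bad event at `l = a_{0:h-1}` with estimated feature `x`.  For each
action `a` in turn, the target `y_a` is the estimated reward plus the result of the recursive call
`rec (a_{0:h-1}, a)`, and `(x, y_a)` is added to `D_{a;h}`.  The targets are collected in `y`. -/
noncomputable def exploreLoop (c : Params A O d)
    (rec : List A → Data A d → Prog A O (ℝ × Data A d)) (l : List A)
    (x : EuclideanSpace ℝ (Fin d)) :
    List A → (A → ℝ) → Data A d → Prog A O ((A → ℝ) × Data A d)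
  | [], y, D => Prog.ret (y, D)
  | a :: as, y, D =>
      (estReward c l a).bind fun r =>
      (rec (l ++ [a]) D).bind fun v =>
      exploreLoop c rec l x as (Function.update y a (r + v.1))
        (v.2.addPair a l.length x (r + v.1))

/-- A bad event: the loop over all actions, after which `x` is added to `D_h`. -/
noncomputable def explore [Fintype A] (c : Params A O d)
    (rec : List A → Data A d → Prog A O (ℝ × Data A d)) (l : List A)
    (x : EuclideanSpace ℝ (Fin d)) (D : Data A d) : Prog A O ((A → ℝ) × Data A d) :=
  (exploreLoop c rec l x Finset.univ.toList (fun _ => 0) D).bind fun z =>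
    Prog.ret (z.1, z.2.addFeat l.length x)

open Classical in
/-- The subroutine `Compute-V*(h; a_{0:h-1})`.  The first argument is the number `H - h` of remaining
steps, and `l = a_{0:h-1}`.  `Compute-V*(H; ·)` is `0`. -/
noncomputable def computeV [Fintype A] [Nonempty A] (c : Params A O d) :
    ℕ → List A → Data A d → Prog A O (ℝ × Data A d)
  | 0, _, D => Prog.ret (0, D)
  | 1, l, D =>
      (rewardLoop c l Finset.univ.toList (fun _ => 0)).bind fun y =>
        Prog.ret (Finset.univ.sup' Finset.univ_nonempty y, D)
  | n + 2, l, D =>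
      (estFeature c l).bind fun x =>
      if D.invNorm c.lam l.length x ≤ c.ε then
        (estReward c l (greedy c D l.length x)).bind fun r =>
        (computeV c (n + 1) (l ++ [greedy c D l.length x]) D).bind fun v =>
        Prog.ret (r + v.1, v.2)
      else
        (explore c (computeV c (n + 1)) l x D).bind fun z =>
        Prog.ret (Finset.univ.sup' Finset.univ_nonempty z.1, z.2)

/-- The `for` loop of the main algorithm: starting from `l = a_{0:h-1}`, choose `n` further greedy
actions.  It returns the whole action sequence and the list of the pairs
`(a_{0:k-1}, x̂_k(a_{0:k-1}))` in the order of increasing `k`. -/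
noncomputable def rollout (c : Params A O d) (D : Data A d) :
    ℕ → List A → Prog A O (List A × List (List A × EuclideanSpace ℝ (Fin d)))
  | 0, l => Prog.ret (l, [])
  | n + 1, l =>
      (estFeature c l).bind fun x =>
      (rollout c D n (l ++ [greedy c D l.length x])).bind fun z =>
      Prog.ret (z.1, (l, x) :: z.2)

open Classical in
/-- At most `n` iterations of the `while` loop of the main algorithm, starting with the data sets
`D`.  The result is `none` if the loop has not been left by then. -/
noncomputable def mainLoop [Fintype A] [Nonempty A] (c : Params A O d) :
    ℕ → Data A d → Prog A O (Option (List A))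
  | 0, _ => Prog.ret none
  | n + 1, D =>
      (rollout c D c.H []).bind fun z =>
      match z.2.find? (fun q => decide (c.ε < D.invNorm c.lam q.1.length q.2)) with
      | none => Prog.ret (some z.1)
      | some q =>
          (explore c (computeV c (c.H - (q.1.length + 1))) q.1 q.2 D).bind fun w =>
          mainLoop c n w.2

/-- The probability that the algorithm, run on `P`, terminates and returns an action sequence `l`
after having used a number `N` of samples such that `E l N` holds.  An episode counts as `H`
samples, whatever part of it is used.  The supremum over the number of iterations that are carried
out of the `while` loop is the limit of an increasing sequence of probabilities. -/
noncomputable def successProb [Fintype A] [Nonempty A] {S : Type*} [MeasurableSpace S]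
    [MeasurableSpace O] (c : Params A O d) (P : POMDP S A O) (E : List A → ℕ → Prop) : ℝ≥0∞ :=
  ⨆ n : ℕ, (mainLoop c n Data.empty).prob P
    (fun out k => ∃ l, out = some l ∧ E l (c.H * k))

end Algorithm

end EQDP

namespace EQDP

/-! ## Ridge regression -/

section Ridge

open Matrix

variable {d : ℕ}

/-! Deterministic transitions make the latent state a function of the executed actions, so a state
can be revisited by replaying its action sequence, and averages over fresh episodes estimate its
mean reward and its mean feature. Left-invertibility turns `⟨w, φ(s)⟩` into `⟨θ, G φ(s)⟩` with `‖θ‖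
≤ W / η(G) ≤ Θ` (`exists_inner_toEuclideanLin_eq`). Hence the optimal Q-function is linear in the
mean observation feature and can be learned by ridge regression.

The threshold `ε` is taken to be `1`. If `‖x‖_{Σ⁻¹} ≤ 1`, the prediction error is at most `√λ Θ + β
√n` for `n` stored targets of accuracy `β` (`abs_ridge_error_le`). The parameters keep the total
error below `Δ / 2`, so the gap makes the greedy action exactly optimal (`Q_greedy`). Regression
errors therefore never enter the computed values: these deviate only by the reward errors along a
path, at most `H · er` (`computeV_spec`), and this in turn bounds `β`. If `‖x‖_{Σ⁻¹} > 1`, storing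
`x` at least doubles `det Σ`, while `det Σ ≤ (n + λ d) ^ d`. So a level stores at most `n₀ = O(d
log(d / λ))` features.

Costs are amortized: every stored feature pays for a bounded number of estimates, which gives `K =
O(H² A² n₀)` estimates in all. Hoeffding's inequality asks for about `(H² + Θ²) n₀ / Δ²` episodes
per estimate, up to logarithms. Failures are handled by the predicate `Ensures`, in which each
estimate costs a factor `1 - δ'` of probability. With `δ' = δ / K`, Bernoulli's inequality leaves at
least `1 - δ`. All integrals are bounded from below only, so the continuation of a program need not
be measurable, whatever the tie-breaking. -/

/-- The regularized Gram matrix `∑ x xᵀ + λ I` of a list of vectors. -/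
noncomputable def ridge (lam : ℝ) (L : List (EuclideanSpace ℝ (Fin d))) :
    Matrix (Fin d) (Fin d) ℝ :=
  (L.map fun x => vecMulVec x.ofLp x.ofLp).sum + lam • 1

theorem Data.Sig_eq_ridge {A : Type*} (D : Data A d) (lam : ℝ) (h : ℕ) :
    D.Sig lam h = ridge lam (D.feats h) := rfl

theorem ridge_nil (lam : ℝ) : ridge (d := d) lam [] = lam • 1 := by simp [ridge]

theorem ridge_cons (lam : ℝ) (x : EuclideanSpace ℝ (Fin d)) (L) :
    ridge lam (x :: L) = vecMulVec x.ofLp x.ofLp + ridge lam L := by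
  simp [ridge, add_assoc]

theorem ridge_append_singleton (lam : ℝ) (L) (x : EuclideanSpace ℝ (Fin d)) :
    ridge lam (L ++ [x]) = ridge lam L + vecMulVec x.ofLp x.ofLp := by
  simp only [ridge, List.map_append, List.sum_append, List.map_cons, List.map_nil, List.sum_cons,
    List.sum_nil, add_zero]
  abel

theorem dotProduct_ridge_mulVec (lam : ℝ) (L : List (EuclideanSpace ℝ (Fin d)))
    (v u : Fin d → ℝ) :
    v ⬝ᵥ (ridge lam L *ᵥ u)
      = (L.map fun x => (x.ofLp ⬝ᵥ u) * (v ⬝ᵥ x.ofLp)).sum + lam * (v ⬝ᵥ u) := by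
  induction L with
  | nil => simp [ridge_nil, smul_mulVec]
  | cons x L ih =>
    rw [ridge_cons, add_mulVec, dotProduct_add, ih, vecMulVec_mulVec]
    simp [dotProduct_smul, add_assoc, mul_comm]

theorem ridge_isHermitian (lam : ℝ) (L : List (EuclideanSpace ℝ (Fin d))) :
    (ridge lam L).IsHermitian := by
  induction L with
  | nil => rw [ridge_nil]; simp [IsHermitian]
  | cons x L ih =>
    rw [ridge_cons]
    refine IsHermitian.add ?_ ih
    ext i j
    simp [vecMulVec_apply, mul_comm]

theorem ridge_posDef {lam : ℝ} (hlam : 0 < lam) (L : List (EuclideanSpace ℝ (Fin d))) :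
    (ridge lam L).PosDef := by
  refine posDef_iff_dotProduct_mulVec.2 ⟨ridge_isHermitian lam L, fun u hu => ?_⟩
  rw [star_trivial, dotProduct_ridge_mulVec]
  have h1 : 0 < u ⬝ᵥ u := by
    refine lt_of_le_of_ne (Finset.sum_nonneg fun i _ => mul_self_nonneg _) (Ne.symm ?_)
    simpa using hu
  have h2 : 0 ≤ (L.map fun x => (x.ofLp ⬝ᵥ u) * (u ⬝ᵥ x.ofLp)).sum := by
    refine List.sum_nonneg fun y hy => ?_
    obtain ⟨x, -, rfl⟩ := List.mem_map.1 hy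
    rw [dotProduct_comm u]
    exact mul_self_nonneg _
  positivity

theorem isUnit_det_ridge {lam : ℝ} (hlam : 0 < lam) (L : List (EuclideanSpace ℝ (Fin d))) :
    IsUnit (ridge lam L).det :=
  (ridge_posDef hlam L).det_pos.ne'.isUnit

/-- The matrix determinant lemma for a rank-one update. A feature with `‖x‖_{Σ⁻¹} > 1` makes the
factor at least `2`, which drives the count of stored features. -/
theorem det_ridge_append {lam : ℝ} (hlam : 0 < lam) (L) (x : EuclideanSpace ℝ (Fin d)) :
    (ridge lam (L ++ [x])).det
      = (ridge lam L).det * (1 + x.ofLp ⬝ᵥ ((ridge lam L)⁻¹ *ᵥ x.ofLp)) := by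
  rw [ridge_append_singleton, vecMulVec_eq Unit,
    det_add_replicateCol_mul_replicateRow (isUnit_det_ridge hlam L)]
  congr 1
  rw [det_unique, Matrix.add_apply, one_apply_eq, Matrix.mul_assoc, ← replicateCol_mulVec]
  simp [Matrix.mul_apply, dotProduct]

theorem dotProduct_self_le_one {x : EuclideanSpace ℝ (Fin d)} (hx : ‖x‖ ≤ 1) :
    x.ofLp ⬝ᵥ x.ofLp ≤ 1 := by
  have h := EuclideanSpace.real_norm_sq_eq x
  have : x.ofLp ⬝ᵥ x.ofLp = ‖x‖ ^ 2 := by rw [h]; simp [dotProduct, sq]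
  rw [this]
  exact pow_le_one₀ (norm_nonneg _) hx

theorem trace_ridge_le (lam : ℝ) {L : List (EuclideanSpace ℝ (Fin d))}
    (hL : ∀ x ∈ L, ‖x‖ ≤ 1) : (ridge lam L).trace ≤ L.length + lam * d := by
  induction L with
  | nil => simp [ridge_nil]
  | cons x L ih =>
    rw [ridge_cons, trace_add, trace_vecMulVec]
    have h1 := dotProduct_self_le_one (hL x (by simp))
    have h2 := ih fun y hy => hL y (by simp [hy])
    push_cast [List.length_cons]
    linarith

/-- The eigenvalues are nonnegative, so each one is at most the trace. The factor `d ^ d` that the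
arithmetic-geometric mean inequality would save only affects logarithms. -/
theorem det_ridge_le {lam : ℝ} (hlam : 0 < lam) {L : List (EuclideanSpace ℝ (Fin d))}
    (hL : ∀ x ∈ L, ‖x‖ ≤ 1) : (ridge lam L).det ≤ (L.length + lam * d) ^ d := by
  have hS := ridge_posDef hlam L
  have htr := trace_ridge_le lam hL
  rw [hS.isHermitian.trace_eq_sum_eigenvalues] at htr
  rw [hS.isHermitian.det_eq_prod_eigenvalues]
  refine (Finset.prod_le_prod (fun i _ => (hS.posSemidef.eigenvalues_nonneg i)) fun i _ =>
    ?_ : _ ≤ ∏ i : Fin d, (L.length + lam * d)).trans (by simp)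
  exact (Finset.single_le_sum (f := fun i => hS.isHermitian.eigenvalues i)
    (fun j _ => hS.posSemidef.eigenvalues_nonneg j) (Finset.mem_univ i)).trans htr

/-- Cauchy–Schwarz, obtained by summing `|f| ≤ (t f² + 1 / t) / 2` with the weight `t = √n`. -/
theorem list_sum_abs_le {ι : Type*} (L : List ι) (f : ι → ℝ)
    (hf : (L.map fun i => f i * f i).sum ≤ 1) :
    (L.map fun i => |f i|).sum ≤ Real.sqrt L.length := by
  rcases L.eq_nil_or_concat with rfl | hne
  · simp
  have hn : 0 < (L.length : ℝ) := by
    obtain ⟨_, _, rfl⟩ := hne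
    simp
    positivity
  set t := Real.sqrt L.length with ht
  have ht0 : 0 < t := Real.sqrt_pos.2 hn
  have key : ∀ L' : List ι, (L'.map fun i => |f i|).sum
      ≤ (t * (L'.map fun i => f i * f i).sum + L'.length / t) / 2 := by
    intro L'
    induction L' with
    | nil => simp
    | cons i L' ih =>
      have h1 : |f i| ≤ (t * (f i * f i) + 1 / t) / 2 := by
        have h2 : |f i| * |f i| = f i * f i := abs_mul_abs_self _
        rw [← h2, le_div_iff₀ (by norm_num : (0 : ℝ) < 2)]
        have h3 : t * (|f i| * |f i|) + 1 / t - |f i| * 2 = (t * |f i| - 1) ^ 2 / t := by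
          field_simp
          ring
        have : 0 ≤ (t * |f i| - 1) ^ 2 / t := by positivity
        linarith
      simp only [List.map_cons, List.sum_cons, List.length_cons]
      push_cast
      calc _ ≤ _ := add_le_add h1 ih
        _ = _ := by ring
  have h := key L
  have h2 : (L.length : ℝ) / t = t := by
    rw [div_eq_iff ht0.ne', ht, Real.mul_self_sqrt hn.le]
  rw [h2] at h
  nlinarith

/-- The prediction error of ridge regression with targets that are linear up to an error `β`. -/
theorem abs_ridge_error_le {lam β Θ : ℝ} (hlam : 0 < lam) (hβ : 0 ≤ β)
    (Z : List (EuclideanSpace ℝ (Fin d) × ℝ)) (θ x : EuclideanSpace ℝ (Fin d))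
    (hθ : ‖θ‖ ≤ Θ) (hZ : ∀ z ∈ Z, |z.2 - θ.ofLp ⬝ᵥ z.1.ofLp| ≤ β)
    (hx : x.ofLp ⬝ᵥ ((ridge lam (Z.map Prod.fst))⁻¹ *ᵥ x.ofLp) ≤ 1) :
    |((ridge lam (Z.map Prod.fst))⁻¹ *ᵥ (Z.map fun z => z.2 • z.1.ofLp).sum) ⬝ᵥ x.ofLp
      - θ.ofLp ⬝ᵥ x.ofLp| ≤ Real.sqrt lam * Θ + β * Real.sqrt Z.length := by
  set S := ridge lam (Z.map Prod.fst) with hS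
  -- With `u = S⁻¹ x`, the hypothesis on `x` reads `∑ ⟨xᵢ, u⟩² + λ ‖u‖² ≤ 1`, and the prediction
  -- error equals `∑ (yᵢ - ⟨θ, xᵢ⟩) ⟨xᵢ, u⟩ - λ ⟨θ, u⟩`. Cauchy–Schwarz applies to each term.
  set u := S⁻¹ *ᵥ x.ofLp with hu
  have hSu : S *ᵥ u = x.ofLp := by
    rw [hu, mulVec_mulVec, mul_nonsing_inv _ (isUnit_det_ridge hlam _), one_mulVec]
  have hsymm : ∀ v : Fin d → ℝ, (S⁻¹ *ᵥ v) ⬝ᵥ x.ofLp = v ⬝ᵥ u := by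
    intro v
    have hT : S⁻¹ᵀ = S⁻¹ := by
      have := (ridge_isHermitian lam (Z.map Prod.fst)).inv
      rwa [IsHermitian, conjTranspose_eq_transpose_of_trivial] at this
    rw [hu, dotProduct_mulVec, ← mulVec_transpose, hT]
  have hquad : ∀ v : Fin d → ℝ, v ⬝ᵥ x.ofLp
      = (Z.map fun z => (z.1.ofLp ⬝ᵥ u) * (v ⬝ᵥ z.1.ofLp)).sum + lam * (v ⬝ᵥ u) := by
    intro v
    rw [← hSu, hS, dotProduct_ridge_mulVec, List.map_map]
    rfl
  have hself : (Z.map fun z => (z.1.ofLp ⬝ᵥ u) * (z.1.ofLp ⬝ᵥ u)).sum + lam * (u ⬝ᵥ u) ≤ 1 := by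
    have := hquad u
    rw [dotProduct_comm u] at this
    simp only [dotProduct_comm u (WithLp.ofLp (Prod.fst _))] at this
    linarith
  have huu : 0 ≤ u ⬝ᵥ u := Finset.sum_nonneg fun i _ => mul_self_nonneg _
  have hsq : 0 ≤ (Z.map fun z => (z.1.ofLp ⬝ᵥ u) * (z.1.ofLp ⬝ᵥ u)).sum :=
    List.sum_nonneg fun y hy => by
      obtain ⟨z, -, rfl⟩ := List.mem_map.1 hy
      exact mul_self_nonneg _
  have hdiff : (S⁻¹ *ᵥ (Z.map fun z => z.2 • z.1.ofLp).sum) ⬝ᵥ x.ofLp - θ.ofLp ⬝ᵥ x.ofLp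
      = (Z.map fun z => (z.2 - θ.ofLp ⬝ᵥ z.1.ofLp) * (z.1.ofLp ⬝ᵥ u)).sum
        - lam * (θ.ofLp ⬝ᵥ u) := by
    rw [hsymm, hquad θ.ofLp]
    have : ∀ Z' : List (EuclideanSpace ℝ (Fin d) × ℝ),
        (Z'.map fun z => z.2 • z.1.ofLp).sum ⬝ᵥ u
          - (Z'.map fun z => (z.1.ofLp ⬝ᵥ u) * (θ.ofLp ⬝ᵥ z.1.ofLp)).sum
        = (Z'.map fun z => (z.2 - θ.ofLp ⬝ᵥ z.1.ofLp) * (z.1.ofLp ⬝ᵥ u)).sum := by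
      intro Z'
      induction Z' with
      | nil => simp
      | cons z Z' ih =>
        simp only [List.map_cons, List.sum_cons, add_dotProduct, smul_dotProduct, smul_eq_mul]
        rw [← ih]
        ring
    rw [← this]
    ring
  have h1 : |(Z.map fun z => (z.2 - θ.ofLp ⬝ᵥ z.1.ofLp) * (z.1.ofLp ⬝ᵥ u)).sum|
      ≤ β * Real.sqrt Z.length := by
    have h2 : ∀ Z' : List (EuclideanSpace ℝ (Fin d) × ℝ),
        (∀ z ∈ Z', |z.2 - θ.ofLp ⬝ᵥ z.1.ofLp| ≤ β) →
        |(Z'.map fun z => (z.2 - θ.ofLp ⬝ᵥ z.1.ofLp) * (z.1.ofLp ⬝ᵥ u)).sum|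
          ≤ β * (Z'.map fun z => |z.1.ofLp ⬝ᵥ u|).sum := by
      intro Z' hZ'
      induction Z' with
      | nil => simp
      | cons z Z' ih =>
        simp only [List.map_cons, List.sum_cons]
        refine (abs_add_le _ _).trans ?_
        rw [mul_add, abs_mul]
        exact add_le_add (mul_le_mul_of_nonneg_right (hZ' z (by simp)) (abs_nonneg _))
          (ih fun y hy => hZ' y (by simp [hy]))
    refine (h2 Z hZ).trans (mul_le_mul_of_nonneg_left ?_ hβ)
    exact list_sum_abs_le Z _ (by nlinarith)
  have h3 : |lam * (θ.ofLp ⬝ᵥ u)| ≤ Real.sqrt lam * Θ := by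
    have hin : θ.ofLp ⬝ᵥ u = inner ℝ θ (WithLp.toLp 2 u) := by
      rw [PiLp.inner_apply]
      simp [dotProduct, mul_comm]
    have hnorm : lam * ‖WithLp.toLp 2 u‖ ^ 2 ≤ 1 := by
      have : ‖WithLp.toLp 2 u‖ ^ 2 = u ⬝ᵥ u := by
        rw [EuclideanSpace.real_norm_sq_eq]
        simp [dotProduct, sq]
      rw [this]
      linarith
    have hl : Real.sqrt lam * ‖WithLp.toLp 2 u‖ ≤ 1 := by
      refine abs_le_of_sq_le_sq' ?_ (by norm_num) |>.2
      rw [mul_pow, Real.sq_sqrt hlam.le]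
      linarith
    have hcs := abs_real_inner_le_norm θ (WithLp.toLp 2 u)
    rw [hin, abs_mul, abs_of_pos hlam]
    have hΘ : 0 ≤ Θ := (norm_nonneg _).trans hθ
    calc lam * |inner ℝ θ (WithLp.toLp 2 u)|
        ≤ lam * (Θ * ‖WithLp.toLp 2 u‖) := by gcongr; exact hcs.trans (by gcongr)
      _ = Real.sqrt lam * Θ * (Real.sqrt lam * ‖WithLp.toLp 2 u‖) := by
        nth_rewrite 1 [← Real.mul_self_sqrt hlam.le]
        ring
      _ ≤ Real.sqrt lam * Θ * 1 := by gcongr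
      _ = _ := mul_one _
  rw [hdiff]
  refine (abs_sub _ _).trans ?_
  linarith

/-! ### Left-invertible matrices and the smallest singular value -/

/-- Expand `‖G v‖²` in an eigenbasis of `Gᵀ G`. Since `k ≤ d`, the index `min d k - 1` is the last
one, `k - 1`, so `η(G)²` is a lower bound for all eigenvalues. -/
theorem smallestSingularValue_mul_norm_le {k : ℕ} (hk : 0 < k) (hkd : k ≤ d)
    (G : Matrix (Fin d) (Fin k) ℝ) (v : EuclideanSpace ℝ (Fin k)) :
    smallestSingularValue G * ‖v‖ ≤ ‖toEuclideanLin G v‖ := by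
  set T := toEuclideanLin G with hT
  have hsymm := T.isSymmetric_adjoint_comp_self
  have hn : Module.finrank ℝ (EuclideanSpace ℝ (Fin k)) = k := by simp
  set b := hsymm.eigenvectorBasis hn with hb
  set σ := smallestSingularValue G with hσ
  have hσ0 : 0 ≤ σ := T.singularValues_nonneg _
  have hσi : ∀ i : Fin k, σ ^ 2 ≤ hsymm.eigenvalues hn i := by
    intro i
    rw [← T.sq_singularValues_fin hn]
    refine pow_le_pow_left₀ hσ0 (T.singularValues_antitone ?_) 2
    have := i.2
    omega
  have h1 : ‖T v‖ ^ 2 = ∑ i, hsymm.eigenvalues hn i * (b.repr v i) ^ 2 := by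
    rw [← real_inner_self_eq_norm_sq, ← LinearMap.adjoint_inner_right,
      ← LinearMap.comp_apply, ← b.repr.inner_map_map, PiLp.inner_apply]
    refine Finset.sum_congr rfl fun i _ => ?_
    rw [hsymm.eigenvectorBasis_apply_self_apply hn v i]
    simp [hb]
    ring
  have h2 : ‖v‖ ^ 2 = ∑ i, (b.repr v i) ^ 2 := by
    rw [← b.repr.norm_map, EuclideanSpace.real_norm_sq_eq]
  refine (abs_le_of_sq_le_sq' ?_ (norm_nonneg _)).2
  rw [mul_pow, h1, h2, Finset.mul_sum]
  exact Finset.sum_le_sum fun i _ => mul_le_mul_of_nonneg_right (hσi i) (sq_nonneg _)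

/-- A linear functional `⟨w, ·⟩` factors through an injective `G` with the norm bound
`‖w‖ / η(G)`. -/
theorem exists_inner_toEuclideanLin_eq {k : ℕ} (hk : 0 < k) (hkd : k ≤ d)
    (G : Matrix (Fin d) (Fin k) ℝ) (hG : 0 < smallestSingularValue G)
    (w : EuclideanSpace ℝ (Fin k)) :
    ∃ θ : EuclideanSpace ℝ (Fin d), ‖θ‖ ≤ ‖w‖ / smallestSingularValue G ∧
      ∀ v, inner ℝ θ (toEuclideanLin G v) = inner ℝ w v := by
  set T := toEuclideanLin G with hT
  have hle := smallestSingularValue_mul_norm_le hk hkd G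
  have hinj : Function.Injective (LinearMap.adjoint T ∘ₗ T) := by
    rw [injective_iff_map_eq_zero]
    intro v hv
    have h0 : ‖T v‖ ^ 2 = 0 := by
      rw [← real_inner_self_eq_norm_sq, ← LinearMap.adjoint_inner_right, ← LinearMap.comp_apply,
        hv, inner_zero_right]
    have h1 : ‖T v‖ = 0 := by simpa using h0
    have h2 := hle v
    rw [← hT, h1] at h2
    by_contra hne
    have := mul_pos hG (norm_pos_iff.2 hne)
    linarith
  -- The witness is `θ = G u` with `Gᵀ G u = w`, which is solvable because the injective
  -- endomorphism `Gᵀ G` is surjective.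
  obtain ⟨u, hu⟩ := (LinearMap.injective_iff_surjective.1 hinj) w
  have hu' : ∀ v, inner ℝ (T u) (T v) = inner ℝ w v := by
    intro v
    rw [← hu, LinearMap.comp_apply, LinearMap.adjoint_inner_left]
  refine ⟨T u, ?_, hu'⟩
  rw [le_div_iff₀ hG]
  by_cases h0 : ‖T u‖ = 0
  · rw [h0, zero_mul]
    exact norm_nonneg _
  have hpos : 0 < ‖T u‖ := lt_of_le_of_ne (norm_nonneg _) (Ne.symm h0)
  refine le_of_mul_le_mul_right ?_ hpos
  calc ‖T u‖ * smallestSingularValue G * ‖T u‖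
      = smallestSingularValue G * ‖T u‖ ^ 2 := by ring
    _ = smallestSingularValue G * inner ℝ w u := by rw [← hu', real_inner_self_eq_norm_sq]
    _ ≤ smallestSingularValue G * (‖w‖ * ‖u‖) := by
        gcongr
        exact real_inner_le_norm _ _
    _ = ‖w‖ * (smallestSingularValue G * ‖u‖) := by ring
    _ ≤ ‖w‖ * ‖T u‖ := by gcongr; exact hle u

theorem le_of_leftInverse {k : ℕ} {G : Matrix (Fin d) (Fin k) ℝ} {Gd : Matrix (Fin k) (Fin d) ℝ}
    (h : Gd * G = 1) : k ≤ d := by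
  have h1 : (Gd * G).rank ≤ G.rank := rank_mul_le_right _ _
  rw [h, rank_one, Fintype.card_fin] at h1
  exact h1.trans (by simpa using G.rank_le_height)

end Ridge

/-! ## Sampling and concentration -/

section Sampling

variable {S A O : Type*} [MeasurableSpace S] [MeasurableSpace O]

theorem Prog.expect_bind {α β : Type*} (P : POMDP S A O) (f : β → ℕ → ℝ≥0∞) (q : Prog A O α)
    (g : α → Prog A O β) (n : ℕ) :
    (q.bind g).expect P f n = q.expect P (fun x m => (g x).expect P f m) n := by
  induction q generalizing n with
  | ret x => rfl
  | observe l k ih => exact lintegral_congr fun o => ih o (n + 1)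
  | reward l a k ih => exact lintegral_congr fun y => ih y (n + 1)

/-- The iterated integral of a function of `M` successive samples of `μ`. -/
noncomputable def iterLintegral {Ω : Type*} [MeasurableSpace Ω] (μ : Measure Ω) :
    ℕ → (List Ω → ℝ≥0∞) → ℝ≥0∞
  | 0, F => F []
  | M + 1, F => ∫⁻ ω, iterLintegral μ M (fun ωs => F (ω :: ωs)) ∂μ

theorem expect_replicate_observe {P : POMDP S A O} {f : List O → ℕ → ℝ≥0∞} (l : List A) (M n : ℕ) :
    (Prog.replicate M (Prog.observe l Prog.ret)).expect P f n
      = iterLintegral (P.obsLaw l) M (fun os => f os (n + M)) := by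
  induction M generalizing n f with
  | zero => rfl
  | succ M ih =>
    refine lintegral_congr fun o => ?_
    change (Prog.bind (Prog.replicate M (Prog.observe l Prog.ret))
      (fun xs => Prog.ret (o :: xs))).expect P f (n + 1) = _
    rw [Prog.expect_bind, ih]
    simp only [Prog.expect, add_assoc, add_comm 1 M]

theorem expect_replicate_reward {P : POMDP S A O} {f : List ℝ → ℕ → ℝ≥0∞} (l : List A) (a : A)
    (M n : ℕ) :
    (Prog.replicate M (Prog.reward l a Prog.ret)).expect P f n
      = iterLintegral (P.rewLaw l a) M (fun ys => f ys (n + M)) := by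
  induction M generalizing n f with
  | zero => rfl
  | succ M ih =>
    refine lintegral_congr fun o => ?_
    change (Prog.bind (Prog.replicate M (Prog.reward l a Prog.ret))
      (fun xs => Prog.ret (o :: xs))).expect P f (n + 1) = _
    rw [Prog.expect_bind, ih]
    simp only [Prog.expect, add_assoc, add_comm 1 M]

/-- An exponential-moment bound for iterated integrals; the integrand need not be measurable. -/
theorem le_iterLintegral {Ω ι : Type*} [MeasurableSpace Ω] [Fintype ι] (μ : Measure Ω)
    [IsProbabilityMeasure μ] (Z : ι → Ω → ℝ) (hZ : ∀ j, Measurable (Z j)) (ρ : ι → ℝ≥0∞)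
    (hρ : ∀ j, ∫⁻ ω, ENNReal.ofReal (Real.exp (Z j ω)) ∂μ ≤ ρ j) (c : ℝ≥0∞) (M : ℕ)
    (K : ι → ℝ≥0∞) (F : List Ω → ℝ≥0∞)
    (hF : ∀ ωs, ωs.length = M →
      c * (1 - ∑ j, K j * ENNReal.ofReal (Real.exp (ωs.map (Z j)).sum)) ≤ F ωs) :
    c * (1 - ∑ j, K j * ρ j ^ M) ≤ iterLintegral μ M F := by
  induction M generalizing K F with
  | zero => simpa [iterLintegral] using hF [] rfl
  | succ M ih =>
    -- The exponential of the first sample is absorbed into the weights `K`, which is why they are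
    -- generalized in the induction.
    have h1 : ∀ ω, c * (1 - ∑ j, K j * ENNReal.ofReal (Real.exp (Z j ω)) * ρ j ^ M)
        ≤ iterLintegral μ M (fun ωs => F (ω :: ωs)) := by
      intro ω
      refine ih (fun j => K j * ENNReal.ofReal (Real.exp (Z j ω))) _ fun ωs hωs => ?_
      refine le_trans (le_of_eq ?_) (hF (ω :: ωs) (by simp [hωs]))
      congr 2
      refine Finset.sum_congr rfl fun j _ => ?_
      rw [List.map_cons, List.sum_cons, Real.exp_add, ENNReal.ofReal_mul (Real.exp_nonneg _),
        mul_assoc]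
    have he : ∀ j, Measurable fun ω => ENNReal.ofReal (Real.exp (Z j ω)) :=
      fun j => (Real.measurable_exp.comp (hZ j)).ennreal_ofReal
    have hm : ∀ j, Measurable fun ω => K j * ENNReal.ofReal (Real.exp (Z j ω)) * ρ j ^ M :=
      fun j => ((he j).const_mul _).mul_const _
    -- Only the explicit measurable minorant is integrated term by term. It is compared with the
    -- true integrand by monotonicity alone.
    calc c * (1 - ∑ j, K j * ρ j ^ (M + 1))
        ≤ c * (∫⁻ _, 1 ∂μ
            - ∫⁻ ω, ∑ j, K j * ENNReal.ofReal (Real.exp (Z j ω)) * ρ j ^ M ∂μ) := by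
          gcongr
          · simp
          · rw [lintegral_finsetSum _ fun j _ => hm j]
            refine Finset.sum_le_sum fun j _ => ?_
            rw [lintegral_mul_const _ ((he j).const_mul _), lintegral_const_mul _ (he j),
              pow_succ, mul_comm (ρ j ^ M), ← mul_assoc]
            gcongr
            exact hρ j
      _ ≤ c * ∫⁻ ω, (1 - ∑ j, K j * ENNReal.ofReal (Real.exp (Z j ω)) * ρ j ^ M) ∂μ := by
          gcongr
          exact lintegral_sub_le _ _ (Finset.measurable_sum _ fun j _ => hm j)
      _ ≤ ∫⁻ ω, c * (1 - ∑ j, K j * ENNReal.ofReal (Real.exp (Z j ω)) * ρ j ^ M) ∂μ :=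
          lintegral_const_mul_le _ _
      _ ≤ _ := lintegral_mono h1

/-- A variable with values in an interval of length `2 R` is sub-Gaussian with variance proxy `R²`.
The choice `t = e / R²` minimizes the Chernoff exponent `t² R² / 2 - t e`. -/
theorem lintegral_exp_le_of_mem_Icc {Ω : Type*} [MeasurableSpace Ω] (μ : Measure Ω)
    [IsProbabilityMeasure μ] {g : Ω → ℝ} (hg : Measurable g) {a R e : ℝ} (hR : 0 < R)
    (hb : ∀ᵐ ω ∂μ, g ω ∈ Set.Icc a (a + 2 * R)) :
    ∫⁻ ω, ENNReal.ofReal (Real.exp (e / R ^ 2 * (g ω - ∫ x, g x ∂μ) - e / R ^ 2 * e)) ∂μ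
      ≤ ENNReal.ofReal (Real.exp (-(e ^ 2 / (2 * R ^ 2)))) := by
  have hs := hasSubgaussianMGF_of_mem_Icc hg.aemeasurable hb
  have h1 := hs.mgf_le (e / R ^ 2)
  have h2 := hs.integrable_exp_mul (e / R ^ 2)
  simp_rw [Real.exp_sub]
  rw [← ofReal_integral_eq_lintegral_ofReal (h2.div_const _)
    (Filter.Eventually.of_forall fun ω => by positivity), integral_div]
  apply ENNReal.ofReal_le_ofReal
  rw [div_le_iff₀ (Real.exp_pos _), ← Real.exp_add]
  refine h1.trans (Real.exp_le_exp.2 (le_of_eq ?_))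
  have h3 : ((( ‖a + 2 * R - a‖₊ / 2) ^ 2 : NNReal) : ℝ) = R ^ 2 := by
    push_cast
    rw [add_sub_cancel_left, Real.norm_of_nonneg (by positivity)]
    ring
  rw [h3]
  field_simp
  ring

/-- **Hoeffding's inequality** for the empirical means of finitely many bounded functions, as a
lower bound for the iterated integral of a function that is at least `c` when all empirical means
are accurate. -/
theorem le_iterLintegral_of_mean_close {Ω ι : Type*} [MeasurableSpace Ω] [Fintype ι]
    (μ : Measure Ω) [IsProbabilityMeasure μ] (g : ι → Ω → ℝ) (hg : ∀ j, Measurable (g j))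
    {a R e : ℝ} (hR : 0 < R) (he : 0 < e) (hb : ∀ j, ∀ᵐ ω ∂μ, g j ω ∈ Set.Icc a (a + 2 * R))
    (c : ℝ≥0∞) {M : ℕ} (hM : 0 < M) (F : List Ω → ℝ≥0∞)
    (hF : ∀ ωs, ωs.length = M →
      (∀ j, |(M : ℝ)⁻¹ * (ωs.map (g j)).sum - ∫ x, g j x ∂μ| ≤ e) → c ≤ F ωs) :
    c * (1 - ENNReal.ofReal (2 * Fintype.card ι * Real.exp (-(M * (e ^ 2 / (2 * R ^ 2))))))
      ≤ iterLintegral μ M F := by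
  -- The Boolean selects the side of the deviation. If an empirical mean is off by more than `e` on
  -- that side, the sum of the corresponding `Z` is nonnegative.
  set Z : ι × Bool → Ω → ℝ := fun j ω => if j.2 then
      e / R ^ 2 * (g j.1 ω - ∫ x, g j.1 x ∂μ) - e / R ^ 2 * e
    else e / R ^ 2 * (-g j.1 ω - ∫ x, -g j.1 x ∂μ) - e / R ^ 2 * e with hZ
  have hZm : ∀ j, Measurable (Z j) := by
    rintro ⟨j, b⟩
    have := hg j
    cases b <;> simp only [hZ] <;> simp <;> fun_prop
  have hρ : ∀ j, ∫⁻ ω, ENNReal.ofReal (Real.exp (Z j ω)) ∂μ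
      ≤ ENNReal.ofReal (Real.exp (-(e ^ 2 / (2 * R ^ 2)))) := by
    rintro ⟨j, b⟩
    cases b
    · simp only [hZ, Bool.false_eq_true, if_false]
      refine lintegral_exp_le_of_mem_Icc (a := -(a + 2 * R)) μ (hg j).neg hR ?_
      filter_upwards [hb j] with ω hω
      simp only [Pi.neg_apply]
      exact ⟨by linarith [hω.2], by linarith [hω.1]⟩
    · simp only [hZ, if_true]
      exact lintegral_exp_le_of_mem_Icc μ (hg j) hR (hb j)
  have hsum : ∀ (j : ι) (r : ℝ) (ωs : List Ω),
      (ωs.map fun ω => e / R ^ 2 * (g j ω - r) - e / R ^ 2 * e).sum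
        = e / R ^ 2 * ((ωs.map (g j)).sum - ωs.length * r - ωs.length * e) := by
    intro j r ωs
    induction ωs with
    | nil => simp
    | cons ω ωs ih =>
      simp only [List.map_cons, List.sum_cons, ih, List.length_cons]
      push_cast
      ring
  have hsum' : ∀ (j : ι) (r : ℝ) (ωs : List Ω),
      (ωs.map fun ω => e / R ^ 2 * (-g j ω - r) - e / R ^ 2 * e).sum
        = e / R ^ 2 * (-(ωs.map (g j)).sum - ωs.length * r - ωs.length * e) := by
    intro j r ωs
    induction ωs with
    | nil => simp
    | cons ω ωs ih =>
      simp only [List.map_cons, List.sum_cons, ih, List.length_cons]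
      push_cast
      ring
  have hM' : (0 : ℝ) < M := by exact_mod_cast hM
  have key := le_iterLintegral μ Z hZm _ hρ c M (fun _ => 1) F (fun ωs hωs => ?_)
  · refine le_trans (le_of_eq ?_) key
    congr 2
    rw [Finset.sum_const, Finset.card_univ, Fintype.card_prod, Fintype.card_bool, one_mul,
      ← ENNReal.ofReal_pow (Real.exp_nonneg _), ← Real.exp_nat_mul, nsmul_eq_mul,
      ENNReal.ofReal_mul (by positivity), ENNReal.ofReal_mul (by norm_num)]
    push_cast
    rw [ENNReal.ofReal_natCast, ENNReal.ofReal_ofNat, mul_neg]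
    ring
  · by_cases hgood : ∀ j, |(M : ℝ)⁻¹ * (ωs.map (g j)).sum - ∫ x, g j x ∂μ| ≤ e
    · exact (mul_le_of_le_one_right' tsub_le_self).trans (hF ωs hωs hgood)
    · push Not at hgood
      obtain ⟨j, hj⟩ := hgood
      have hbad : ∃ b, 0 ≤ (ωs.map (Z (j, b))).sum := by
        rcases lt_abs.1 hj with h | h
        · refine ⟨true, ?_⟩
          simp only [hZ, if_true]
          rw [hsum, hωs]
          refine mul_nonneg (by positivity) ?_
          have := mul_lt_mul_of_pos_left h hM'
          rw [mul_sub, mul_inv_cancel_left₀ hM'.ne'] at this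
          linarith
        · refine ⟨false, ?_⟩
          simp only [hZ, Bool.false_eq_true, if_false]
          rw [hsum', hωs, integral_neg]
          refine mul_nonneg (by positivity) ?_
          have := mul_lt_mul_of_pos_left h hM'
          rw [mul_neg, mul_sub, mul_inv_cancel_left₀ hM'.ne'] at this
          linarith
      obtain ⟨b, hb'⟩ := hbad
      -- In the bad case one exponential is at least `1`, so the truncated subtraction in the lower
      -- bound gives `0`.
      have h1 : (1 : ℝ≥0∞)
          ≤ ∑ j, 1 * ENNReal.ofReal (Real.exp (ωs.map (Z j)).sum) := by
        refine le_trans ?_ (Finset.single_le_sum (fun _ _ => zero_le) (Finset.mem_univ (j, b)))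
        rw [one_mul, ENNReal.one_le_ofReal]
        exact Real.one_le_exp hb'
      rw [tsub_eq_zero_of_le h1, mul_zero]
      exact zero_le

/-- `q` ends in a result `x`, after a multiple `j * M` of `M` episodes, such that `Q x j` holds,
up to failures that cost a factor `s` per `M` episodes in the probability of what is to come. -/
def Ensures (P : POMDP S A O) (M : ℕ) (s : ℝ≥0∞) {α : Type*} (q : Prog A O α)
    (Q : α → ℕ → Prop) : Prop :=
  ∀ (f : α → ℕ → ℝ≥0∞) (n : ℕ) (w : ℝ≥0∞),
    (∀ x j, Q x j → w * s ^ j ≤ f x (n + j * M)) → w ≤ q.expect P f n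

/-! ### Composition rules for probabilistic specifications. -/

namespace Ensures

variable {P : POMDP S A O} {M : ℕ} {s : ℝ≥0∞} {α β : Type*}

theorem ret {x : α} {Q : α → ℕ → Prop} (h : Q x 0) : Ensures P M s (Prog.ret x) Q := by
  intro f n w hf
  simpa [Prog.expect] using hf x 0 h

theorem mono {q : Prog A O α} {Q R : α → ℕ → Prop} (h : Ensures P M s q Q)
    (hQR : ∀ x j, Q x j → R x j) : Ensures P M s q R :=
  fun f n w hf => h f n w fun x j hx => hf x j (hQR x j hx)

/-- After `j` batches the continuation is run with the weight `w * s ^ j` in place of `w`. Thus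
batch counts add and failure factors multiply, without a union bound over adaptively chosen events.
-/
theorem bind {q : Prog A O α} {g : α → Prog A O β} {Q : α → ℕ → Prop} {R : β → ℕ → Prop}
    (h : Ensures P M s q Q) (hg : ∀ x j, Q x j → Ensures P M s (g x) fun y k => R y (j + k)) :
    Ensures P M s (q.bind g) R := by
  intro f n w hf
  rw [Prog.expect_bind]
  refine h _ n w fun x j hx => hg x j hx f _ _ fun y k hy => ?_
  rw [mul_assoc, ← pow_add, add_assoc, ← add_mul]
  exact hf y (j + k) hy

end Ensures

/-! ### Accuracy of the feature and reward estimates. -/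

theorem inner_inv_smul_sum {d : ℕ} {Ω : Type*} (ψ : Ω → EuclideanSpace ℝ (Fin d)) (r : ℝ)
    (os : List Ω) (θ : EuclideanSpace ℝ (Fin d)) :
    inner ℝ θ (r • (os.map ψ).sum) = r * (os.map fun o => inner ℝ θ (ψ o)).sum := by
  rw [inner_smul_right]
  congr 1
  induction os with
  | nil => simp
  | cons o os ih => simp [inner_add_right, ih]

theorem norm_mean_le_one {d : ℕ} {Ω : Type*} {ψ : Ω → EuclideanSpace ℝ (Fin d)}
    (hψ : ∀ o, ‖ψ o‖ ≤ 1) {M : ℕ} (hM : 0 < M) {os : List Ω} (hos : os.length = M) :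
    ‖(M : ℝ)⁻¹ • (os.map ψ).sum‖ ≤ 1 := by
  have h : ∀ os : List Ω, ‖(os.map ψ).sum‖ ≤ os.length := by
    intro os
    induction os with
    | nil => simp
    | cons o os ih =>
      simp only [List.map_cons, List.sum_cons, List.length_cons]
      push_cast
      exact (norm_add_le _ _).trans (by linarith [hψ o])
  have hM' : (0 : ℝ) < M := by exact_mod_cast hM
  rw [norm_smul, norm_inv, Real.norm_natCast, inv_mul_le_iff₀ hM', mul_one]
  exact hos ▸ h os

/-- Only the functionals `⟨θ a, ·⟩` matter, one per action. Each is bounded by `Θ`, so scalar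
Hoeffding bounds suffice and no dimension-dependent control of the vector error is needed. -/
theorem ensures_estFeature {d : ℕ} [Fintype A] (P : POMDP S A O) (c : Params A O d) (l : List A)
    [IsProbabilityMeasure (P.obsLaw l)] (hψ : Measurable c.ψ) (hψ1 : ∀ o, ‖c.ψ o‖ ≤ 1)
    (hM : 0 < c.M) (θ : A → EuclideanSpace ℝ (Fin d)) {Θ e : ℝ} (hΘ : 0 < Θ) (he : 0 < e)
    (hθ : ∀ a, ‖θ a‖ ≤ Θ) {s : ℝ≥0∞}
    (hs : 1 ≤ s * (1 - ENNReal.ofReal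
      (2 * Fintype.card A * Real.exp (-(c.M * (e ^ 2 / (2 * Θ ^ 2))))))) :
    Ensures P c.M s (estFeature c l) fun x j => j = 1 ∧ ‖x‖ ≤ 1 ∧
      ∀ a, |inner ℝ (θ a) x - ∫ o, inner ℝ (θ a) (c.ψ o) ∂(P.obsLaw l)| ≤ e := by
  intro f n w hf
  rw [estFeature, Prog.expect_bind, expect_replicate_observe]
  have key := le_iterLintegral_of_mean_close (P.obsLaw l) (fun a o => inner ℝ (θ a) (c.ψ o))
    (fun a => measurable_const.inner hψ) (a := -Θ) hΘ he (fun a => Filter.Eventually.of_forall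
      fun o => ?_) (w * s) hM (fun os => (Prog.ret ((c.M : ℝ)⁻¹ • (os.map c.ψ).sum)).expect P f
      (n + c.M)) (fun os hos hgood => ?_)
  · refine le_trans ?_ key
    rw [mul_assoc]
    exact le_mul_of_one_le_right' hs
  · have h1 : |inner ℝ (θ a) (c.ψ o)| ≤ Θ := by
      refine (abs_real_inner_le_norm _ _).trans ?_
      calc ‖θ a‖ * ‖c.ψ o‖ ≤ Θ * 1 := by gcongr; exacts [hθ a, hψ1 o]
        _ = Θ := mul_one _
    rw [abs_le] at h1
    exact ⟨h1.1, by linarith [h1.2]⟩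
  · have := hf ((c.M : ℝ)⁻¹ • (os.map c.ψ).sum) 1
      ⟨rfl, norm_mean_le_one hψ1 hM hos, fun a => by rw [inner_inv_smul_sum]; exact hgood a⟩
    simpa [Prog.expect] using this

theorem ensures_estReward {d : ℕ} (P : POMDP S A O) (c : Params A O d) (l : List A) (a : A)
    [IsProbabilityMeasure (P.rewLaw l a)]
    (hr : ∀ᵐ y ∂(P.rewLaw l a), y ∈ Set.Icc (0 : ℝ) 1)
    (hM : 0 < c.M) {e : ℝ} (he : 0 < e) {s : ℝ≥0∞}
    (hs : 1 ≤ s * (1 - ENNReal.ofReal (2 * Real.exp (-(c.M * (2 * e ^ 2)))))) :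
    Ensures P c.M s (estReward c l a) fun y j => j = 1 ∧
      |y - ∫ z, z ∂(P.rewLaw l a)| ≤ e := by
  intro f n w hf
  rw [estReward, Prog.expect_bind, expect_replicate_reward]
  have key := le_iterLintegral_of_mean_close (ι := Unit) (P.rewLaw l a) (fun _ y => y)
    (fun _ => measurable_id) (a := 0) (R := 1 / 2) (by norm_num) he
    (fun _ => by simpa using hr) (w * s) hM
    (fun ys => (Prog.ret ((c.M : ℝ)⁻¹ * ys.sum)).expect P f (n + c.M)) (fun ys hys hgood => ?_)
  · refine le_trans ?_ key
    rw [mul_assoc]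
    refine le_mul_of_one_le_right' (hs.trans (le_of_eq ?_))
    simp only [Fintype.card_unit, Nat.cast_one, mul_one]
    congr 6
    ring
  · have := hf ((c.M : ℝ)⁻¹ * ys.sum) 1 ⟨rfl, by simpa using hgood ()⟩
    simpa [Prog.expect] using this

end Sampling

/-! ## Analysis of the algorithm -/

section Analysis

open Matrix

variable {S A O : Type*} [MeasurableSpace S] [MeasurableSpace O] {d : ℕ}

theorem inner_eq_dotProduct (θ x : EuclideanSpace ℝ (Fin d)) :
    inner ℝ θ x = θ.ofLp ⬝ᵥ x.ofLp := by
  rw [PiLp.inner_apply]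
  simp [dotProduct, mul_comm]

/-- What the analysis of the algorithm uses: values of action sequences that satisfy the Bellman
equation with a gap, accurate estimators, and suitable parameters. -/
structure AccurateModel [Fintype A] [Nonempty A] (P : POMDP S A O) (c : Params A O d) (s : ℝ≥0∞)
    (V : List A → ℝ) (Q r : List A → A → ℝ) (θ : A → ℕ → EuclideanSpace ℝ (Fin d))
    (Δ Θ er ef : ℝ) (n₀ : ℕ) : Prop where
  lam_pos : 0 < c.lam
  eps_eq : c.ε = 1
  er_nonneg : 0 ≤ er
  ef_nonneg : 0 ≤ ef
  argmax_le : ∀ (f : A → ℝ) (a : A), f a ≤ f (c.argmax f)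
  reward : ∀ l a, l.length < c.H →
    Ensures P c.M s (estReward c l a) fun y j => j = 1 ∧ |y - r l a| ≤ er
  feature : ∀ l, l.length < c.H → Ensures P c.M s (estFeature c l) fun x j =>
    j = 1 ∧ ‖x‖ ≤ 1 ∧ ∀ a, |inner ℝ (θ a l.length) x - Q l a| ≤ ef
  Q_eq : ∀ l a, l.length < c.H → Q l a = r l a + V (l ++ [a])
  V_eq : ∀ l, l.length < c.H → V l = Finset.univ.sup' Finset.univ_nonempty (Q l)
  V_end : ∀ l, l.length = c.H → V l = 0
  gap : ∀ l a, l.length < c.H → 0 < V l - Q l a → Δ ≤ V l - Q l a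
  norm_le : ∀ a h, h < c.H → ‖θ a h‖ ≤ Θ
  card_le : ∀ n : ℕ, 2 ^ n * c.lam ^ d ≤ (n + c.lam * d) ^ d → n ≤ n₀
  accuracy : Real.sqrt c.lam * Θ + (c.H * er + ef) * Real.sqrt n₀ + ef < Δ / 2

/-- The invariant that the data sets of one level satisfy when no `explore` is active there. -/
structure GoodLevel (lam β : ℝ) (θ : A → ℕ → EuclideanSpace ℝ (Fin d)) (D : Data A d) (h : ℕ) :
    Prop where
  norm_le : ∀ x ∈ D.feats h, ‖x‖ ≤ 1
  le_det : 2 ^ (D.feats h).length * lam ^ d ≤ (ridge lam (D.feats h)).det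
  pairs_fst : ∀ a, (D.pairs a h).map Prod.fst = D.feats h
  pairs_err : ∀ a, ∀ z ∈ D.pairs a h, |z.2 - inner ℝ (θ a h) z.1| ≤ β

/-- The level `h` of two families of data sets agree. -/
def SameLevel (D D' : Data A d) (h : ℕ) : Prop :=
  D'.feats h = D.feats h ∧ ∀ a, D'.pairs a h = D.pairs a h

theorem SameLevel.refl (D : Data A d) (h : ℕ) : SameLevel D D h := ⟨rfl, fun _ => rfl⟩

theorem SameLevel.trans {D D' D'' : Data A d} {h : ℕ} (h₁ : SameLevel D D' h)
    (h₂ : SameLevel D' D'' h) : SameLevel D D'' h :=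
  ⟨h₂.1.trans h₁.1, fun a => (h₂.2 a).trans (h₁.2 a)⟩

theorem GoodLevel.congr {lam β : ℝ} {θ : A → ℕ → EuclideanSpace ℝ (Fin d)} {D D' : Data A d}
    {h : ℕ} (hD : GoodLevel lam β θ D h) (hs : SameLevel D D' h) : GoodLevel lam β θ D' h :=
  ⟨by rw [hs.1]; exact hD.norm_le, by rw [hs.1]; exact hD.le_det,
    fun a => by rw [hs.1, hs.2]; exact hD.pairs_fst a,
    fun a => by rw [hs.2]; exact hD.pairs_err a⟩

theorem goodLevel_empty (lam β : ℝ) (θ : A → ℕ → EuclideanSpace ℝ (Fin d)) (h : ℕ) :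
    GoodLevel lam β θ Data.empty h := by
  refine ⟨by simp [Data.empty], ?_, fun a => rfl, by simp [Data.empty]⟩
  simp [Data.empty, ridge_nil]

/-- The number of features that have been stored below the horizon. -/
def Data.size (D : Data A d) (H : ℕ) : ℕ := ∑ h ∈ Finset.range H, (D.feats h).length

theorem Data.size_addPair (D : Data A d) (a : A) (h : ℕ) (x : EuclideanSpace ℝ (Fin d)) (y : ℝ)
    (H : ℕ) : (D.addPair a h x y).size H = D.size H := rfl

theorem Data.size_addFeat (D : Data A d) {h H : ℕ} (hh : h < H)
    (x : EuclideanSpace ℝ (Fin d)) : (D.addFeat h x).size H = D.size H + 1 := by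
  have h1 : ∀ k, ((D.addFeat h x).feats k).length
      = (D.feats k).length + if k = h then 1 else 0 := by
    intro k
    by_cases hk : k = h
    · subst hk
      simp [Data.addFeat]
    · simp [Data.addFeat, hk]
  simp only [Data.size, h1, Finset.sum_add_distrib]
  simp [hh]

theorem sameLevel_addPair (D : Data A d) (a : A) {h k : ℕ} (hk : k ≠ h)
    (x : EuclideanSpace ℝ (Fin d)) (y : ℝ) : SameLevel D (D.addPair a h x y) k :=
  ⟨rfl, fun b => by simp [Data.addPair, hk]⟩

theorem sameLevel_addFeat (D : Data A d) {h k : ℕ} (hk : k ≠ h)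
    (x : EuclideanSpace ℝ (Fin d)) : SameLevel D (D.addFeat h x) k :=
  ⟨by simp [Data.addFeat, hk], fun b => rfl⟩

/-- The total reward collected along `t` after `l`. -/
def pathReward (r : List A → A → ℝ) : List A → List A → ℝ
  | _, [] => 0
  | l, a :: t => r l a + pathReward r (l ++ [a]) t

theorem abs_sup'_sub_sup'_le [Fintype A] [Nonempty A] {f g : A → ℝ} {e : ℝ}
    (h : ∀ a, |f a - g a| ≤ e) :
    |Finset.univ.sup' Finset.univ_nonempty f - Finset.univ.sup' Finset.univ_nonempty g| ≤ e := by
  rw [abs_sub_le_iff, sub_le_iff_le_add, sub_le_iff_le_add]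
  constructor
  · refine Finset.sup'_le _ _ fun a ha => ?_
    have h1 := (abs_sub_le_iff.1 (h a)).1
    have h2 := Finset.le_sup' g ha
    linarith
  · refine Finset.sup'_le _ _ fun a ha => ?_
    have h1 := (abs_sub_le_iff.1 (h a)).2
    have h2 := Finset.le_sup' f ha
    linarith

/-! ### Correctness and amortized cost of the subroutines. -/

namespace AccurateModel

variable [Fintype A] [Nonempty A] {P : POMDP S A O} {c : Params A O d} {s : ℝ≥0∞}
  {V : List A → ℝ} {Q r : List A → A → ℝ} {θ : A → ℕ → EuclideanSpace ℝ (Fin d)}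
  {Δ Θ er ef : ℝ} {n₀ : ℕ}

theorem length_feats_le (hm : AccurateModel P c s V Q r θ Δ Θ er ef n₀) {β : ℝ}
    {D : Data A d} {h : ℕ} (hD : GoodLevel c.lam β θ D h) : (D.feats h).length ≤ n₀ :=
  hm.card_le _ (hD.le_det.trans (det_ridge_le hm.lam_pos hD.norm_le))

theorem size_le (hm : AccurateModel P c s V Q r θ Δ Θ er ef n₀) {β : ℝ}
    {D : Data A d} (hD : ∀ h, GoodLevel c.lam β θ D h) : D.size c.H ≤ c.H * n₀ := by
  refine (Finset.sum_le_sum fun h _ => hm.length_feats_le (hD h)).trans ?_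
  simp

theorem Q_le_V (hm : AccurateModel P c s V Q r θ Δ Θ er ef n₀) {l : List A}
    (hl : l.length < c.H) (a : A) : Q l a ≤ V l := by
  rw [hm.V_eq l hl]
  exact Finset.le_sup' (Q l) (Finset.mem_univ a)

/-- When the uncertainty is small, the greedy action is optimal. -/
theorem Q_greedy (hm : AccurateModel P c s V Q r θ Δ Θ er ef n₀) {l : List A}
    (hl : l.length < c.H) {D : Data A d}
    (hD : GoodLevel c.lam (c.H * er + ef) θ D l.length) {x : EuclideanSpace ℝ (Fin d)}
    (hx : ∀ a, |inner ℝ (θ a l.length) x - Q l a| ≤ ef)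
    (hn : D.invNorm c.lam l.length x ≤ c.ε) : Q l (greedy c D l.length x) = V l := by
  have hβ : 0 ≤ c.H * er + ef :=
    add_nonneg (mul_nonneg (Nat.cast_nonneg _) hm.er_nonneg) hm.ef_nonneg
  have hn' : x.ofLp ⬝ᵥ ((ridge c.lam (D.feats l.length))⁻¹ *ᵥ x.ofLp) ≤ 1 := by
    rw [hm.eps_eq, Data.invNorm, Real.sqrt_le_iff] at hn
    simpa [Data.Sig_eq_ridge] using hn.2
  have hclose : ∀ a, |D.thetaHat c.lam a l.length ⬝ᵥ x.ofLp - Q l a| < Δ / 2 := by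
    intro a
    have h1 := abs_ridge_error_le hm.lam_pos hβ (D.pairs a l.length) (θ a l.length) x
      (hm.norm_le a _ hl)
      (fun z hz => by rw [← inner_eq_dotProduct]; exact hD.pairs_err a z hz)
      (by rw [hD.pairs_fst]; exact hn')
    rw [hD.pairs_fst, ← inner_eq_dotProduct (θ a _)] at h1
    have hlen : ((D.pairs a l.length).length : ℝ) ≤ n₀ := by
      have := hm.length_feats_le hD
      rw [← hD.pairs_fst a, List.length_map] at this
      exact_mod_cast this
    have h2 : (c.H * er + ef) * Real.sqrt (D.pairs a l.length).length
        ≤ (c.H * er + ef) * Real.sqrt n₀ := by gcongr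
    have h3 := hx a
    have h4 := hm.accuracy
    have h5 := abs_sub_le (D.thetaHat c.lam a l.length ⬝ᵥ x.ofLp)
      (inner ℝ (θ a l.length) x) (Q l a)
    have h6 : |D.thetaHat c.lam a l.length ⬝ᵥ x.ofLp - inner ℝ (θ a l.length) x|
      ≤ Real.sqrt c.lam * Θ + (c.H * er + ef) * Real.sqrt (D.pairs a l.length).length := h1
    linarith
  -- Both the optimal action `b` and the greedy one are predicted within less than `Δ / 2`. A
  -- suboptimal greedy action would have a gap in `(0, Δ)`.
  obtain ⟨b, -, hb⟩ := Finset.exists_mem_eq_sup' Finset.univ_nonempty (Q l)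
  rw [← hm.V_eq l hl] at hb
  have h1 := hm.argmax_le (fun a => D.thetaHat c.lam a l.length ⬝ᵥ x.ofLp) b
  have h2 := (abs_lt.1 (hclose b)).1
  have h3 := (abs_lt.1 (hclose (greedy c D l.length x))).2
  have h4 := hm.Q_le_V hl (greedy c D l.length x)
  have h5 := hm.gap l (greedy c D l.length x) hl
  have h6 : D.thetaHat c.lam b l.length ⬝ᵥ x.ofLp
    ≤ D.thetaHat c.lam (greedy c D l.length x) l.length ⬝ᵥ x.ofLp := h1
  by_contra hne
  have h7 := h5 (sub_pos.2 (lt_of_le_of_ne h4 hne))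
  linarith

theorem rewardLoop_spec (hm : AccurateModel P c s V Q r θ Δ Θ er ef n₀) {l : List A}
    (hl : l.length < c.H) (as : List A) (y : A → ℝ) :
    Ensures P c.M s (rewardLoop c l as y) fun y' j => j = as.length ∧
      (∀ b ∈ as, |y' b - r l b| ≤ er) ∧ ∀ b ∉ as, y' b = y b := by
  classical
  induction as generalizing y with
  | nil => exact Ensures.ret ⟨rfl, by simp, fun _ _ => rfl⟩
  | cons a as ih =>
    refine (hm.reward l a hl).bind fun z j hz => ?_
    obtain ⟨rfl, hz⟩ := hz
    refine (ih _).mono fun y' k hy => ?_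
    obtain ⟨rfl, h1, h2⟩ := hy
    refine ⟨by simp [add_comm], fun b hb => ?_, fun b hb => ?_⟩
    · by_cases hbs : b ∈ as
      · exact h1 b hbs
      · obtain rfl : b = a := by simpa [hbs] using hb
        rw [h2 b hbs, Function.update_self]
        exact hz
    · simp only [List.mem_cons, not_or] at hb
      rw [h2 b hb.2, Function.update_of_ne hb.1]

/-- A bound on the number of estimates per stored feature. -/
def exploreCost (A : Type*) [Fintype A] (H : ℕ) : ℕ :=
  Fintype.card A * (1 + 2 * H + Fintype.card A)

/-- The specification of `computeV` with `n` steps to go. -/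
def ComputeSpec (P : POMDP S A O) (c : Params A O d) (s : ℝ≥0∞) (V : List A → ℝ)
    (θ : A → ℕ → EuclideanSpace ℝ (Fin d)) (er ef : ℝ) (n : ℕ)
    (f : List A → Data A d → Prog A O (ℝ × Data A d)) : Prop :=
  ∀ l D, l.length + n = c.H →
    (∀ k, l.length ≤ k → GoodLevel c.lam (c.H * er + ef) θ D k) →
    Ensures P c.M s (f l D) fun v j => |v.1 - V l| ≤ n * er ∧
      (∀ k, l.length ≤ k → GoodLevel c.lam (c.H * er + ef) θ v.2 k) ∧
      (∀ k, k < l.length → SameLevel D v.2 k) ∧ D.size c.H ≤ v.2.size c.H ∧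
      -- The cost is amortized against the size of the data. Outside of explorations, a step uses at
      -- most one feature and one reward estimate, hence `2 * n`, and the last step estimates all
      -- `A` rewards.
      j + exploreCost A c.H * D.size c.H
        ≤ 2 * n + Fintype.card A + exploreCost A c.H * v.2.size c.H

/-- Within the loop the current level has received pairs but not yet the feature, so `GoodLevel` is
false there in general. The recursive calls only use deeper levels, so the invariant is carried for
those, while the current level is tracked exactly. -/
theorem exploreLoop_spec (hm : AccurateModel P c s V Q r θ Δ Θ er ef n₀) {n : ℕ}
    {f : List A → Data A d → Prog A O (ℝ × Data A d)} (hf : ComputeSpec P c s V θ er ef n f)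
    {l : List A} (hl : l.length + (n + 1) = c.H) (x : EuclideanSpace ℝ (Fin d))
    (as : List A) (has : as.Nodup) (y : A → ℝ) (D : Data A d)
    (hD : ∀ k, l.length < k → GoodLevel c.lam (c.H * er + ef) θ D k) :
    Ensures P c.M s (exploreLoop c f l x as y D) fun z j =>
      (∀ b ∈ as, |z.1 b - Q l b| ≤ (n + 1) * er) ∧
      (∀ k, l.length < k → GoodLevel c.lam (c.H * er + ef) θ z.2 k) ∧
      (∀ k, k < l.length → SameLevel D z.2 k) ∧
      z.2.feats l.length = D.feats l.length ∧
      (∀ b ∈ as, z.2.pairs b l.length = D.pairs b l.length ++ [(x, z.1 b)]) ∧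
      (∀ b ∉ as, z.2.pairs b l.length = D.pairs b l.length ∧ z.1 b = y b) ∧
      D.size c.H ≤ z.2.size c.H ∧
      j + exploreCost A c.H * D.size c.H
        ≤ as.length * (1 + 2 * n + Fintype.card A) + exploreCost A c.H * z.2.size c.H := by
  classical
  induction as generalizing y D with
  | nil =>
    exact Ensures.ret ⟨by simp, hD, fun k _ => SameLevel.refl _ _, rfl, by simp,
      fun _ _ => ⟨rfl, rfl⟩, le_rfl, by simp⟩
  | cons a as ih =>
    have hlH : l.length < c.H := by omega
    obtain ⟨ha, has⟩ := List.nodup_cons.1 has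
    refine (hm.reward l a hlH).bind fun ρ j hρ => ?_
    obtain ⟨rfl, hρ⟩ := hρ
    refine (hf (l ++ [a]) D (by simp; omega) fun k hk => hD k (by simp at hk; omega)).bind
      fun v j hv => ?_
    obtain ⟨v1, v2, v3, v4, v5⟩ := hv
    have hsame : SameLevel D v.2 l.length := v3 _ (by simp)
    refine (ih has _ _ fun k hk => ?_).mono fun z i hz => ?_
    · exact (v2 k (by simp; omega)).congr (sameLevel_addPair _ _ (by omega) _ _)
    obtain ⟨z1, z2, z3, z4, z5, z6, z7, z8⟩ := hz
    rw [Data.size_addPair] at z7 z8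
    refine ⟨fun b hb => ?_, z2, fun k hk => ?_, ?_, fun b hb => ?_, fun b hb => ?_,
      v4.trans z7, ?_⟩
    · by_cases hbs : b ∈ as
      · exact z1 b hbs
      · obtain rfl : b = a := by simpa [hbs] using hb
        rw [(z6 b hbs).2, Function.update_self, hm.Q_eq l b hlH]
        have h1 := abs_add_le (ρ - r l b) (v.1 - V (l ++ [b]))
        have h2 : ρ + v.1 - (r l b + V (l ++ [b])) = ρ - r l b + (v.1 - V (l ++ [b])) := by ring
        rw [h2]
        linarith
    · exact ((v3 k (by simp; omega)).trans (sameLevel_addPair _ _ hk.ne _ _)).trans (z3 k hk)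
    · rw [z4]
      exact hsame.1
    · by_cases hbs : b ∈ as
      · have hba : b ≠ a := fun h => ha (h ▸ hbs)
        rw [z5 b hbs, ← hsame.2 b]
        simp [Data.addPair, hba]
      · obtain rfl : b = a := by simpa [hbs] using hb
        rw [(z6 b hbs).1, (z6 b hbs).2, Function.update_self, ← hsame.2 b]
        simp [Data.addPair]
    · simp only [List.mem_cons, not_or] at hb
      rw [(z6 b hb.2).1, (z6 b hb.2).2, Function.update_of_ne hb.1, ← hsame.2 b]
      simp [Data.addPair, hb.1]
    · rw [List.length_cons, add_mul]
      omega

/-- Appending `x` restores the invariant: the large uncertainty doubles the determinant, and the new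
targets are off by at most `(n + 1) * er + ef ≤ H * er + ef`. The added feature pays for the `A`
reward estimates and for the part of the `A` recursive calls that is not charged to their own
features. -/
theorem explore_spec (hm : AccurateModel P c s V Q r θ Δ Θ er ef n₀) {n : ℕ}
    {f : List A → Data A d → Prog A O (ℝ × Data A d)} (hf : ComputeSpec P c s V θ er ef n f)
    {l : List A} (hl : l.length + (n + 1) = c.H) {x : EuclideanSpace ℝ (Fin d)}
    (hx1 : ‖x‖ ≤ 1) (hx : ∀ a, |inner ℝ (θ a l.length) x - Q l a| ≤ ef) {D : Data A d}
    (hbad : c.ε < D.invNorm c.lam l.length x)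
    (hD : ∀ k, l.length ≤ k → GoodLevel c.lam (c.H * er + ef) θ D k) :
    Ensures P c.M s (explore c f l x D) fun z j =>
      (∀ b, |z.1 b - Q l b| ≤ (n + 1) * er) ∧
      (∀ k, l.length ≤ k → GoodLevel c.lam (c.H * er + ef) θ z.2 k) ∧
      (∀ k, k < l.length → SameLevel D z.2 k) ∧
      D.size c.H + 1 ≤ z.2.size c.H ∧
      j + exploreCost A c.H * D.size c.H ≤ exploreCost A c.H * z.2.size c.H := by
  have hlH : l.length < c.H := by omega
  refine (hm.exploreLoop_spec hf hl x _ (Finset.nodup_toList _) _ D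
    fun k hk => hD k hk.le).bind fun z j hz => Ensures.ret ?_
  obtain ⟨z1, z2, z3, z4, z5, -, z7, z8⟩ := hz
  have hsize := Data.size_addFeat z.2 hlH x
  refine ⟨fun b => z1 b (by simp), fun k hk => ?_, fun k hk => ?_, ?_, ?_⟩
  · rcases hk.lt_or_eq with hk | rfl
    · exact (z2 k hk).congr (sameLevel_addFeat _ hk.ne' _)
    have hDl := hD l.length le_rfl
    have hfe : (z.2.addFeat l.length x).feats l.length = D.feats l.length ++ [x] := by
      simp [Data.addFeat, z4]
    have hpa : ∀ a, (z.2.addFeat l.length x).pairs a l.length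
        = D.pairs a l.length ++ [(x, z.1 a)] := fun a => z5 a (by simp)
    constructor
    · rw [hfe]
      intro w hw
      rcases List.mem_append.1 hw with hw | hw
      · exact hDl.norm_le w hw
      · rw [List.mem_singleton.1 hw]
        exact hx1
    · rw [hfe, det_ridge_append hm.lam_pos, List.length_append, List.length_singleton, pow_succ]
      have h1 : 1 ≤ x.ofLp ⬝ᵥ ((ridge c.lam (D.feats l.length))⁻¹ *ᵥ x.ofLp) := by
        rw [hm.eps_eq, Data.invNorm, Real.lt_sqrt zero_le_one] at hbad
        simpa [Data.Sig_eq_ridge] using hbad.le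
      have h2 := hDl.le_det
      have h3 := (ridge_posDef hm.lam_pos (D.feats l.length)).det_pos
      nlinarith
    · intro a
      rw [hpa, hfe, List.map_append, hDl.pairs_fst]
      rfl
    · intro a w hw
      rw [hpa] at hw
      rcases List.mem_append.1 hw with hw | hw
      · exact hDl.pairs_err a w hw
      · rw [List.mem_singleton.1 hw]
        have h1 := z1 a (by simp)
        have h2 := hx a
        have h3 := abs_sub_le (z.1 a) (Q l a) (inner ℝ (θ a l.length) x)
        rw [abs_sub_comm (Q l a)] at h3
        have h4 : ((n : ℝ) + 1) * er ≤ c.H * er := by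
          refine mul_le_mul_of_nonneg_right ?_ hm.er_nonneg
          exact_mod_cast (by omega : n + 1 ≤ c.H)
        change |z.1 a - inner ℝ (θ a l.length) x| ≤ _
        linarith
  · exact (z3 k hk).trans (sameLevel_addFeat _ hk.ne _)
  · change _ ≤ (z.2.addFeat l.length x).size c.H
    omega
  · change _ ≤ _ * (z.2.addFeat l.length x).size c.H
    rw [hsize, mul_add]
    have h1 : (Finset.univ : Finset A).toList.length * (1 + 2 * n + Fintype.card A)
        ≤ exploreCost A c.H * 1 := by
      rw [Finset.length_toList, Finset.card_univ, mul_one, exploreCost]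
      gcongr
      omega
    omega

/-- In the good case `Q_greedy` gives `V l = r l a + V (l ++ [a])` exactly, so each step adds only
one reward error. In the bad case the maximum over actions is 1-Lipschitz in the targets. -/
theorem computeV_spec (hm : AccurateModel P c s V Q r θ Δ Θ er ef n₀) (n : ℕ) :
    ComputeSpec P c s V θ er ef n (computeV c n) := by
  induction n with
  | zero =>
    intro l D hl hD
    refine Ensures.ret ⟨?_, hD, fun k _ => SameLevel.refl _ _, le_rfl, by dsimp only; omega⟩
    simp [hm.V_end l hl]
  | succ n ih =>
    intro l D hl hD
    have hlH : l.length < c.H := by omega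
    cases n with
    | zero =>
      refine (hm.rewardLoop_spec hlH _ _).bind fun y j hy => Ensures.ret ?_
      obtain ⟨rfl, h1, -⟩ := hy
      refine ⟨?_, hD, fun k _ => SameLevel.refl _ _, le_rfl, ?_⟩
      · rw [hm.V_eq l hlH]
        refine abs_sup'_sub_sup'_le fun a => ?_
        rw [hm.Q_eq l a hlH, hm.V_end _ (by simpa using hl)]
        simpa using h1 a (by simp)
      · simp only [Finset.length_toList, Finset.card_univ]
        omega
    | succ n =>
      refine (hm.feature l hlH).bind fun x j hx => ?_
      obtain ⟨rfl, hx1, hx⟩ := hx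
      split_ifs with hgood
      · have hV := hm.Q_greedy hlH (hD _ le_rfl) hx hgood
        set a := greedy c D l.length x
        refine (hm.reward l a hlH).bind fun ρ j hρ => ?_
        obtain ⟨rfl, hρ⟩ := hρ
        refine (ih (l ++ [a]) D (by simp; omega)
          fun k hk => hD k (by simp at hk; omega)).bind fun v j hv => Ensures.ret ?_
        obtain ⟨v1, v2, v3, v4, v5⟩ := hv
        refine ⟨?_, fun k hk => ?_, fun k hk => v3 k (by simp; omega), v4, ?_⟩
        · rw [← hV, hm.Q_eq l a hlH]
          have h1 := abs_add_le (ρ - r l a) (v.1 - V (l ++ [a]))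
          have h2 : ρ + v.1 - (r l a + V (l ++ [a])) = ρ - r l a + (v.1 - V (l ++ [a])) := by ring
          change |ρ + v.1 - _| ≤ _
          rw [h2]
          push_cast at v1 ⊢
          linarith
        · rcases hk.lt_or_eq with hk | rfl
          · exact v2 k (by simp; omega)
          · exact (hD _ le_rfl).congr (v3 _ (by simp))
        · dsimp only
          omega
      · refine (hm.explore_spec ih hl hx1 hx (not_le.1 hgood) hD).bind
          fun z j hz => Ensures.ret ?_
        obtain ⟨z1, z2, z3, z4, z5⟩ := hz
        refine ⟨?_, z2, z3, by dsimp only; omega, by dsimp only; omega⟩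
        rw [hm.V_eq l hlH]
        refine abs_sup'_sub_sup'_le fun a => ?_
        simpa using z1 a

/-- If all uncertainties are small, every greedy action is optimal, and the Bellman equation
telescopes along the path. -/
theorem rollout_spec (hm : AccurateModel P c s V Q r θ Δ Θ er ef n₀) {D : Data A d}
    (hD : ∀ k, GoodLevel c.lam (c.H * er + ef) θ D k) (n : ℕ) (l : List A)
    (hl : l.length + n = c.H) :
    Ensures P c.M s (rollout c D n l) fun z j => j = n ∧
      (∀ q ∈ z.2, q.1.length < c.H ∧ ‖q.2‖ ≤ 1 ∧
        ∀ a, |inner ℝ (θ a q.1.length) q.2 - Q q.1 a| ≤ ef) ∧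
      ((∀ q ∈ z.2, D.invNorm c.lam q.1.length q.2 ≤ c.ε) →
        ∃ t, z.1 = l ++ t ∧ t.length = n ∧ pathReward r l t = V l) := by
  induction n generalizing l with
  | zero =>
    refine Ensures.ret ⟨rfl, by simp, fun _ => ⟨[], by simp, rfl, ?_⟩⟩
    rw [hm.V_end l hl]
    rfl
  | succ n ih =>
    have hlH : l.length < c.H := by omega
    refine (hm.feature l hlH).bind fun x j hx => ?_
    obtain ⟨rfl, hx1, hx⟩ := hx
    refine (ih _ (by simp; omega)).bind fun z j hz => Ensures.ret ?_
    obtain ⟨rfl, h1, h2⟩ := hz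
    refine ⟨by omega, fun q hq => ?_, fun hq => ?_⟩
    · rcases List.mem_cons.1 hq with rfl | hq
      · exact ⟨hlH, hx1, hx⟩
      · exact h1 q hq
    · have hV := hm.Q_greedy hlH (hD _) hx (hq (l, x) (by simp))
      obtain ⟨t, ht1, ht2, ht3⟩ := h2 fun q hq' => hq q (by simp [hq'])
      refine ⟨greedy c D l.length x :: t, by simpa using ht1, by simp [ht2], ?_⟩
      rw [pathReward, ht3, ← hm.Q_eq l _ hlH, hV]

/-- Every unfinished iteration stores a feature, and at most `H * n₀` can be stored, so the loop is
left before the allowed iterations run out. The `H` feature estimates of such an iteration are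
charged to the new feature. Those of the last iteration give the additive `c.H`. -/
theorem mainLoop_spec (hm : AccurateModel P c s V Q r θ Δ Θ er ef n₀) (n : ℕ) {D : Data A d}
    (hD : ∀ k, GoodLevel c.lam (c.H * er + ef) θ D k) (hn : c.H * n₀ < D.size c.H + n) :
    Ensures P c.M s (mainLoop c n D) fun out j =>
      (∃ l, out = some l ∧ l.length = c.H ∧ pathReward r [] l = V []) ∧
      j + (exploreCost A c.H + c.H) * D.size c.H
        ≤ c.H + (exploreCost A c.H + c.H) * (c.H * n₀) := by
  induction n generalizing D with
  | zero =>
    have := hm.size_le hD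
    omega
  | succ n ih =>
    refine (hm.rollout_spec hD c.H [] (by simp)).bind fun z j hz => ?_
    obtain ⟨rfl, h1, h2⟩ := hz
    have hsize := hm.size_le hD
    split
    · rename_i hfind
      refine Ensures.ret ⟨⟨z.1, rfl, ?_⟩, ?_⟩
      · obtain ⟨t, ht1, ht2, ht3⟩ := h2 fun q hq => by
          simpa using List.find?_eq_none.1 hfind q hq
        rw [ht1]
        exact ⟨ht2, ht3⟩
      · gcongr
        exact le_rfl
    · rename_i q hfind
      have hq := List.find?_some hfind
      rw [decide_eq_true_eq] at hq
      obtain ⟨hqH, hq1, hqe⟩ := h1 q (List.mem_of_find?_eq_some hfind)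
      refine (hm.explore_spec (hm.computeV_spec _) (by omega) hq1 hqe hq
        fun k _ => hD k).bind fun w j hw => ?_
      obtain ⟨-, w2, w3, w4, w5⟩ := hw
      have hw : ∀ k, GoodLevel c.lam (c.H * er + ef) θ w.2 k := by
        intro k
        rcases lt_or_ge k q.1.length with hk | hk
        · exact (hD k).congr (w3 k hk)
        · exact w2 k hk
      refine (ih hw (by omega)).mono fun out i ho => ⟨ho.1, ?_⟩
      have h3 := ho.2
      have h4 : c.H * (D.size c.H + 1) ≤ c.H * w.2.size c.H := Nat.mul_le_mul_left _ w4
      rw [add_mul] at h3 ⊢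
      rw [mul_add, mul_one] at h4
      omega

/-- The algorithm succeeds with probability at least `s⁻¹ ^ k`, where `k` bounds the number of
estimates. -/
theorem le_successProb (hm : AccurateModel P c s V Q r θ Δ Θ er ef n₀) (hs : 1 ≤ s)
    {w : ℝ≥0∞} (hw : w * s ^ (c.H + (exploreCost A c.H + c.H) * (c.H * n₀)) ≤ 1)
    {E : List A → ℕ → Prop}
    (hE : ∀ l j, l.length = c.H → pathReward r [] l = V [] →
      j ≤ c.H + (exploreCost A c.H + c.H) * (c.H * n₀) → E l (c.H * (j * c.M))) :
    w ≤ successProb c P E := by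
  refine le_trans ?_ (le_iSup _ (c.H * n₀ + 1))
  refine hm.mainLoop_spec _ (fun k => goodLevel_empty _ _ _ k) (by omega) _ 0 w
    fun out j hout => ?_
  obtain ⟨⟨l, rfl, hl, hV⟩, hj⟩ := hout
  have hj' : j ≤ c.H + (exploreCost A c.H + c.H) * (c.H * n₀) := le_trans (Nat.le_add_right _ _) hj
  rw [if_pos ⟨l, rfl, by rw [zero_add]; exact hE l j hl hV hj'⟩]
  exact le_trans (by gcongr) hw

end AccurateModel

end Analysis

/-! ## POMDPs with deterministic latent transitions -/

namespace POMDP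

/-- The state that is reached from `s` at time `h` by a list of actions. -/
def stateAt {S A : Type*} (p : ℕ → S → A → S) : ℕ → S → List A → S
  | _, s, [] => s
  | h, s, a :: l => stateAt p (h + 1) (p h s a) l

theorem stateAt_append_singleton {S A : Type*} (p : ℕ → S → A → S) (h : ℕ) (s : S) (l : List A) (a : A) :
    stateAt p h s (l ++ [a]) = p (h + l.length) (stateAt p h s l) a := by
  induction l generalizing h s with
  | nil => rfl
  | cons b l ih =>
    simp only [List.cons_append, stateAt, ih, List.length_cons]
    congr 1
    omega

variable {S A O : Type*} [MeasurableSpace S] [MeasurableSpace O]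

instance isMarkovKernel_emit (P : POMDP S A O) (h : ℕ) : IsMarkovKernel (P.emit h) :=
  P.emit_markov h

instance isMarkovKernel_rew (P : POMDP S A O) (h : ℕ) (a : A) : IsMarkovKernel (P.rew h a) :=
  P.rew_markov h a

variable {P : POMDP S A O} {p : ℕ → S → A → S} {H : ℕ}

theorem stateLawFrom_dirac
    (hp : ∀ h < H, ∀ s a, P.trans h a s = Measure.dirac (p h s a)) (h : ℕ) (s : S) (l : List A)
    (hl : h + l.length ≤ H) :
    P.stateLawFrom h (Measure.dirac s) l = Measure.dirac (stateAt p h s l) := by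
  induction l generalizing h s with
  | nil => rfl
  | cons a l ih =>
    simp only [List.length_cons] at hl
    rw [stateLawFrom, Measure.dirac_bind (P.trans h a).measurable, hp h (by omega),
      ih _ _ (by omega)]
    rfl

theorem obsLaw_eq (hp : ∀ h < H, ∀ s a, P.trans h a s = Measure.dirac (p h s a)) {l : List A}
    (hl : l.length ≤ H) : P.obsLaw l = P.emit l.length (stateAt p 0 P.init l) := by
  rw [obsLaw, stateLaw, stateLawFrom_dirac hp _ _ _ (by omega),
    Measure.dirac_bind (P.emit _).measurable]

theorem rewLaw_eq (hp : ∀ h < H, ∀ s a, P.trans h a s = Measure.dirac (p h s a)) {l : List A}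
    (hl : l.length ≤ H) (a : A) :
    P.rewLaw l a = P.rew l.length a (stateAt p 0 P.init l) := by
  rw [rewLaw, stateLaw, stateLawFrom_dirac hp _ _ _ (by omega),
    Measure.dirac_bind (P.rew _ _).measurable]

theorem lintegral_rew (P : POMDP S A O) (h : ℕ) (s : S) (a : A) :
    ∫⁻ y, ENNReal.ofReal y ∂(P.rew h a s) = ENNReal.ofReal (P.meanReward h s a) := by
  have hb := P.rew_mem h a s
  refine (ofReal_integral_eq_lintegral_ofReal
    (Integrable.of_mem_Icc 0 1 aemeasurable_id hb) ?_).symm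
  filter_upwards [hb] with y hy using hy.1

theorem meanReward_nonneg (P : POMDP S A O) (h : ℕ) (s : S) (a : A) : 0 ≤ P.meanReward h s a := by
  refine integral_nonneg_of_ae ?_
  filter_upwards [P.rew_mem h a s] with y hy using hy.1

/-! ### Values of general policies and of open-loop action sequences. -/

section Values

variable [Fintype A] [Nonempty A]

theorem Vstar_eq {h : ℕ} (hh : h < H) (s : S) :
    P.Vstar p H h s = P.valueToGo p (H - h) h s := by
  obtain ⟨n, hn⟩ : ∃ n, H - h = n + 1 := ⟨H - h - 1, by omega⟩
  have hn' : H - (h + 1) = n := by omega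
  rw [Vstar, hn, valueToGo]
  simp only [Qstar, hh, if_true, hn']

theorem valueToGo_nonneg (P : POMDP S A O) (p : ℕ → S → A → S) (n h : ℕ) (s : S) :
    0 ≤ P.valueToGo p n h s := by
  induction n generalizing h s with
  | zero => exact le_rfl
  | succ n ih =>
    let a := Classical.arbitrary A
    exact (add_nonneg (P.meanReward_nonneg h s a) (ih _ _)).trans
      (Finset.le_sup' (fun a : A => P.meanReward h s a + P.valueToGo p n (h + 1) (p h s a))
        (Finset.mem_univ a))

/-- Passing to a measurable minorant gives this direction for every function. It is needed because
values of an arbitrary policy need not be measurable in the state. -/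
theorem lintegral_dirac_le {α : Type*} [MeasurableSpace α] (x : α) (f : α → ℝ≥0∞) :
    ∫⁻ y, f y ∂(Measure.dirac x) ≤ f x := by
  obtain ⟨g, hg, hgf, hfg⟩ := exists_measurable_le_lintegral_eq (Measure.dirac x) f
  rw [hfg, lintegral_dirac' x hg]
  exact hgf x

/-- No history-dependent policy has a larger value than `V*`. -/
theorem policyValueFrom_le (hp : ∀ h < H, ∀ s a, P.trans h a s = Measure.dirac (p h s a))
    (π : Policy A O) (n h : ℕ) (hn : h + n ≤ H) (s : S) (hist : List (O × A × ℝ)) :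
    P.policyValueFrom π n h s hist ≤ ENNReal.ofReal (P.valueToGo p n h s) := by
  induction n generalizing h s hist with
  | zero => simp [policyValueFrom]
  | succ n ih =>
    have h1 : ∀ o (a : A), ∫⁻ y, (ENNReal.ofReal y + ∫⁻ s', P.policyValueFrom π n (h + 1) s'
        (hist ++ [(o, a, y)]) ∂(P.trans h a s)) ∂(P.rew h a s)
        ≤ ENNReal.ofReal (P.valueToGo p (n + 1) h s) := by
      intro o a
      calc _ ≤ ∫⁻ y, (ENNReal.ofReal y
              + ENNReal.ofReal (P.valueToGo p n (h + 1) (p h s a))) ∂(P.rew h a s) := by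
            refine lintegral_mono fun y => ?_
            dsimp only
            gcongr
            rw [hp h (by omega)]
            exact (lintegral_dirac_le _ _).trans (ih _ (by omega) _ _)
        _ = ENNReal.ofReal (P.meanReward h s a + P.valueToGo p n (h + 1) (p h s a)) := by
            rw [lintegral_add_right _ measurable_const, lintegral_rew, lintegral_const,
              measure_univ, mul_one,
              ENNReal.ofReal_add (P.meanReward_nonneg h s a) (P.valueToGo_nonneg p _ _ _)]
        _ ≤ _ := by
            apply ENNReal.ofReal_le_ofReal
            exact Finset.le_sup' (fun a : A => P.meanReward h s a
              + P.valueToGo p n (h + 1) (p h s a)) (Finset.mem_univ a)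
    calc P.policyValueFrom π (n + 1) h s hist
        ≤ ∫⁻ _, ENNReal.ofReal (P.valueToGo p (n + 1) h s) ∂(P.emit h s) := by
          refine lintegral_mono fun o => ?_
          calc _ ≤ ∑ a : A, π hist o a * ENNReal.ofReal (P.valueToGo p (n + 1) h s) :=
                Finset.sum_le_sum fun a _ => by gcongr; exact h1 o a
            _ = _ := by
                rw [← Finset.sum_mul, ← tsum_fintype (L := .unconditional A), PMF.tsum_coe, one_mul]
      _ = _ := by simp

/-- The action that `openLoop l` plays at time `h`. -/
noncomputable def openLoopAction (l : List A) (h : ℕ) : A :=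
  (l[h]?).getD (Classical.arbitrary A)

theorem policyValueFrom_openLoop_succ (l : List A) (n : ℕ) (F : S → ℝ≥0∞) (h : ℕ)
    (hF : ∀ s hist, hist.length = h + 1 → P.policyValueFrom (openLoop l) n (h + 1) s hist = F s)
    (s : S) (hist : List (O × A × ℝ)) (hh : hist.length = h) :
    P.policyValueFrom (openLoop l) (n + 1) h s hist
      = ENNReal.ofReal (P.meanReward h s (openLoopAction l h))
        + ∫⁻ s', F s' ∂(P.trans h (openLoopAction l h) s) := by
  have h1 : ∀ (o : O) (a : A) (y : ℝ) s', P.policyValueFrom (openLoop l) n (h + 1) s'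
      (hist ++ [(o, a, y)]) = F s' := fun o a y s' => hF s' _ (by simp [hh])
  simp only [policyValueFrom, h1]
  classical
  have h2 : ∀ (o : O) (a : A), openLoop (O := O) l hist o a
      = if a = openLoopAction l h then 1 else 0 := by
    intro o a
    simp only [openLoop, hh, PMF.pure_apply, openLoopAction]
    congr
  simp only [h2, ite_mul, one_mul, zero_mul, Finset.sum_ite_eq', Finset.mem_univ, if_true,
    lintegral_const, measure_univ, mul_one]
  rw [lintegral_add_right _ measurable_const, lintegral_rew, lintegral_const, measure_univ, mul_one]

/-- An open-loop policy reads only the length of the history, so its value is a function of the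
state, and this function is measurable. This allows exact evaluation against Dirac measures, where
an inequality would not suffice. -/
theorem exists_policyValueFrom_openLoop (P : POMDP S A O) (l : List A) (n h : ℕ) :
    ∃ F : S → ℝ≥0∞, Measurable F ∧ ∀ s hist, hist.length = h →
      P.policyValueFrom (openLoop l) n h s hist = F s := by
  induction n generalizing h with
  | zero => exact ⟨0, measurable_const, fun _ _ _ => rfl⟩
  | succ n ih =>
    obtain ⟨F, hF, hF'⟩ := ih (h + 1)
    refine ⟨_, ?_, policyValueFrom_openLoop_succ l n F h hF'⟩
    simp only [← lintegral_rew]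
    exact (Measurable.lintegral_kernel ENNReal.measurable_ofReal).add
      (Measurable.lintegral_kernel hF)

theorem policyValueFrom_openLoop
    (hp : ∀ h < H, ∀ s a, P.trans h a s = Measure.dirac (p h s a)) (l t : List A)
    (hl : l.length + t.length ≤ H) (hist : List (O × A × ℝ)) (hh : hist.length = l.length) :
    P.policyValueFrom (openLoop (l ++ t)) t.length l.length (stateAt p 0 P.init l) hist
      = ENNReal.ofReal (pathReward
        (fun l a => P.meanReward l.length (stateAt p 0 P.init l) a) l t) := by
  induction t generalizing l hist with
  | nil => simp [policyValueFrom, pathReward]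
  | cons a t ih =>
    -- Some observation is needed to build a dummy history of the next length for the induction
    -- hypothesis.
    obtain ⟨o⟩ : Nonempty O := (P.emit 0 P.init).nonempty_of_neZero
    simp only [List.length_cons] at hl
    have ha : openLoopAction (l ++ a :: t) l.length = a := by simp [openLoopAction]
    have hla : l ++ a :: t = l ++ [a] ++ t := by simp
    obtain ⟨F, hF, hF'⟩ := exists_policyValueFrom_openLoop P (l ++ a :: t) t.length (l.length + 1)
    rw [List.length_cons, policyValueFrom_openLoop_succ _ _ F _ hF' _ _ hh, ha,
      hp _ (by omega), lintegral_dirac' _ hF, pathReward, ENNReal.ofReal_add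
        (P.meanReward_nonneg _ _ _)]
    · congr 1
      rw [← ih (l ++ [a]) (by simp; omega) (hist ++ [(o, a, 0)]) (by simp [hh]), ← hla]
      simp only [List.length_append, List.length_singleton, stateAt_append_singleton, zero_add]
      rw [hF' _ _ (by simp [hh])]
    · clear * -
      generalize l ++ [a] = l'
      induction t generalizing l' with
      | nil => exact le_rfl
      | cons b t ih => exact add_nonneg (P.meanReward_nonneg _ _ _) (ih _)

/-- The optimal value bounds all policies from above, and the open-loop policy attains it. -/
theorem isOptimalSeq_of_pathReward
    (hp : ∀ h < H, ∀ s a, P.trans h a s = Measure.dirac (p h s a)) {l : List A}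
    (hl : l.length = H)
    (hV : pathReward (fun l a => P.meanReward l.length (stateAt p 0 P.init l) a) [] l
      = P.valueToGo p H 0 P.init) : P.IsOptimalSeq H l := by
  refine ⟨hl, fun π => ?_⟩
  have h1 := policyValueFrom_openLoop hp [] l (by simp [hl]) [] rfl
  rw [hV, List.nil_append, hl] at h1
  exact (policyValueFrom_le hp π H 0 (by omega) P.init []).trans (le_of_eq h1.symm)

end Values

end POMDP

/-! ## The choice of the parameters -/

section Parameters

/-- The elliptical potential argument: a number of doublings of the determinant that is compatible
with the trace bound is `O(d log (d / λ))`. -/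
theorem le_of_two_pow_mul_le {d : ℕ} (hd : 0 < d) {lam : ℝ} (hlam : 0 < lam) (hlam1 : lam ≤ 1)
    {n : ℕ} (h : 2 ^ n * lam ^ d ≤ (n + lam * d) ^ d) :
    (n : ℝ) ≤ 4 * (d * Real.log (4 * d / lam)) := by
  have hd0 : (0 : ℝ) < d := by exact_mod_cast hd
  have hd1 : (1 : ℝ) ≤ d := by exact_mod_cast hd
  have hu : (0 : ℝ) < n + lam * d := by positivity
  have h1 := Real.log_le_log (by positivity) h
  rw [Real.log_mul (by positivity) (by positivity), Real.log_pow, Real.log_pow, Real.log_pow] at h1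
  -- Taking the tangent of the logarithm at `4 d` leaves only `n / 4` on the right, which `n log 2 ≥
  -- n / 2` absorbs.
  have h2 := Real.log_le_sub_one_of_pos (x := (n + lam * d) / (4 * d)) (by positivity)
  rw [Real.log_div hu.ne' (by positivity)] at h2
  have h3 : Real.log (4 * d / lam) = Real.log (4 * d) - Real.log lam :=
    Real.log_div (by positivity) hlam.ne'
  have h4 : 0 ≤ Real.log (4 * d / lam) := by
    apply Real.log_nonneg
    rw [le_div_iff₀ hlam]
    linarith
  have h5 := Real.log_two_gt_d9
  have h6 : (d : ℝ) * (Real.log (n + lam * d) - Real.log (4 * d))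
      ≤ d * ((n + lam * d) / (4 * d) - 1) := by gcongr
  have h7 : (d : ℝ) * ((n + lam * d) / (4 * d) - 1) = n / 4 + lam * d / 4 - d := by
    field_simp
  have h8 : lam * d ≤ 1 * d := by gcongr
  have h9 : (n : ℝ) * Real.log 2 ≤ n / 4 + d * Real.log (4 * d / lam) := by
    rw [h3]
    nlinarith
  have h10 : (0 : ℝ) ≤ n := Nat.cast_nonneg n
  have h11 : 0 ≤ (d : ℝ) * Real.log (4 * d / lam) := by positivity
  nlinarith

/-- The bound on the number of estimates, each of which uses `M` episodes. -/
def estimateBound (A H n₀ : ℕ) : ℕ := H + (A * (1 + 2 * H + A) + H) * (H * n₀)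

theorem estimateBound_le {A H n₀ : ℕ} (hA : 0 < A) (hH : 0 < H) (hn : 0 < n₀) :
    estimateBound A H n₀ ≤ 6 * (H ^ 2 * A ^ 2 * n₀) := by
  have h1 : A * (1 + 2 * H + A) ≤ 4 * (A ^ 2 * H) := by
    calc A * (1 + 2 * H + A) ≤ A * (A * H + 2 * (A * H) + A * H) := by
          gcongr
          · exact Nat.mul_pos hA hH
          · exact Nat.le_mul_of_pos_left _ hA
          · exact Nat.le_mul_of_pos_right _ hH
      _ = _ := by ring
  have h2 : H ≤ A ^ 2 * H := Nat.le_mul_of_pos_left _ (by positivity)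
  have h3 : H ≤ H ^ 2 * A ^ 2 * n₀ := by
    calc H = H ^ 1 * 1 * 1 := by ring
      _ ≤ H ^ 2 * A ^ 2 * n₀ := by
        gcongr
        · norm_num
        · exact Nat.one_le_pow _ _ hA
        · exact hn
  calc estimateBound A H n₀ ≤ H ^ 2 * A ^ 2 * n₀ + (4 * (A ^ 2 * H) + A ^ 2 * H) * (H * n₀) := by
        unfold estimateBound
        gcongr
    _ = _ := by ring

/-- If `x` is below the exponential of `L`, raised to the power `k`, then `log x ≤ k L`. -/
theorem log_le_mul_of_le_exp_pow {x L : ℝ} (hx : 0 < x) {k : ℕ} (h : x ≤ Real.exp L ^ k) :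
    Real.log x ≤ k * L := by
  rw [Real.log_le_iff_le_exp hx, Real.exp_nat_mul]
  exact h

/-- The final arithmetic: `K` estimates of `M` episodes each, of length `H`. -/
theorem sample_bound {H A d n Θ Δ L ℓ K M T Λ : ℝ} (hH1 : 1 ≤ H) (hΘ : 1 ≤ Θ) (hΔ : 0 < Δ)
    (hR1 : 1 ≤ Θ / Δ) (hn1 : 1 ≤ n) (hL1 : 1 ≤ L) (hℓ2 : 1 / 2 ≤ ℓ)
    (hK : K ≤ 6 * (H ^ 2 * A ^ 2 * n)) (hn : n ≤ 54 * (d * L)) (hΛ0 : 0 ≤ Λ) (hΛ : Λ ≤ 35 * (L * ℓ))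
    (hT : T = 512 * (H ^ 2 + Θ ^ 2) * n * Λ / Δ ^ 2) (hM0 : 0 ≤ M) (hM : M ≤ T + 2) :
    H * (K * M) ≤ 10 ^ 9 * (L ^ 3 * (H ^ 5 * (Θ / Δ) ^ 5 * d ^ 2 * A ^ 2 * ℓ)) := by
  have hΘ0 : 0 < Θ := by linarith
  set R := Θ / Δ with hR
  have hLℓ : 1 / 2 ≤ L * ℓ := by nlinarith
  have hLℓ0 : 0 ≤ L * ℓ := by linarith
  have h1 : 1 ≤ H ^ 2 * R ^ 2 * n :=
    one_le_mul_of_one_le_of_one_le (one_le_mul_of_one_le_of_one_le (one_le_pow₀ hH1)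
      (one_le_pow₀ hR1)) hn1
  have hMle : M ≤ 35844 * (H ^ 2 * R ^ 2 * n) * (L * ℓ) := by
    have h3 : T ≤ 512 * (2 * (H ^ 2 * Θ ^ 2)) * n * (35 * (L * ℓ)) / Δ ^ 2 := by
      rw [hT]
      gcongr
      have hH2 : 1 ≤ H ^ 2 := one_le_pow₀ hH1
      have hΘ2 : 1 ≤ Θ ^ 2 := one_le_pow₀ hΘ
      nlinarith
    have h4 : 512 * (2 * (H ^ 2 * Θ ^ 2)) * n * (35 * (L * ℓ)) / Δ ^ 2
        = 35840 * (H ^ 2 * R ^ 2 * n) * (L * ℓ) := by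
      rw [hR, div_pow]
      ring
    have h5 : 1 * (L * ℓ) ≤ H ^ 2 * R ^ 2 * n * (L * ℓ) := by gcongr
    linarith
  -- The argument yields `(Θ / Δ) ^ 2`. The fifth power is a weakening that uses `Δ ≤ Θ`.
  have hR5 : R ^ 2 ≤ R ^ 5 := pow_le_pow_right₀ hR1 (by norm_num)
  clear_value R
  calc H * (K * M)
      ≤ H * (6 * (H ^ 2 * A ^ 2 * n) * (35844 * (H ^ 2 * R ^ 2 * n) * (L * ℓ))) := by gcongr
    _ = 215064 * (H ^ 5 * A ^ 2 * R ^ 2 * L * ℓ) * n ^ 2 := by ring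
    _ ≤ 215064 * (H ^ 5 * A ^ 2 * R ^ 5 * L * ℓ) * (54 * (d * L)) ^ 2 := by gcongr
    _ = 627126624 * (L ^ 3 * (H ^ 5 * R ^ 5 * d ^ 2 * A ^ 2 * ℓ)) := by ring
    _ ≤ 10 ^ 9 * (L ^ 3 * (H ^ 5 * R ^ 5 * d ^ 2 * A ^ 2 * ℓ)) := by
        have : 0 ≤ R := by linarith
        gcongr
        norm_num

/-- A sample size that suffices for the accuracies that the regression needs. -/
theorem le_mul_sq_accuracy {H n Θ Δ M Λ : ℝ} (hH : 0 < H) (hΘ : 0 < Θ) (hΔ : 0 < Δ) (hn : 0 < n)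
    (hΛ : 0 ≤ Λ) (hM : 512 * (H ^ 2 + Θ ^ 2) * n * Λ / Δ ^ 2 ≤ M) :
    Λ ≤ M * ((Δ / (16 * Real.sqrt n)) ^ 2 / (2 * Θ ^ 2)) ∧
      Λ ≤ M * (2 * (Δ / (16 * H * Real.sqrt n)) ^ 2) := by
  have hsq2 : Real.sqrt n ^ 2 = n := Real.sq_sqrt hn.le
  constructor
  · have h2 : (Δ / (16 * Real.sqrt n)) ^ 2 / (2 * Θ ^ 2) = Δ ^ 2 / (512 * n * Θ ^ 2) := by
      rw [div_pow, mul_pow, hsq2, div_div]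
      congr 1
      ring
    rw [h2]
    calc Λ = 512 * Θ ^ 2 * n * Λ / Δ ^ 2 * (Δ ^ 2 / (512 * n * Θ ^ 2)) := by field_simp
      _ ≤ M * (Δ ^ 2 / (512 * n * Θ ^ 2)) := by
        gcongr
        refine le_trans ?_ hM
        gcongr
        nlinarith
  · have h2 : 2 * (Δ / (16 * H * Real.sqrt n)) ^ 2 = Δ ^ 2 / (128 * n * H ^ 2) := by
      rw [div_pow, mul_pow, mul_pow, hsq2]
      field_simp
      norm_num
    rw [h2]
    calc Λ = 128 * H ^ 2 * n * Λ / Δ ^ 2 * (Δ ^ 2 / (128 * n * H ^ 2)) := by field_simp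
      _ ≤ M * (Δ ^ 2 / (128 * n * H ^ 2)) := by
        gcongr
        refine le_trans ?_ hM
        gcongr
        · norm_num
        · nlinarith

/-- Parameters for which the analysis applies, together with the resulting sample bound. -/
theorem exists_parameters {A H d : ℕ} {Θ Δ δ : ℝ} (hA : 0 < A) (hH : 0 < H) (hd : 0 < d)
    (hΘ : 1 ≤ Θ) (hΔ : 0 < Δ) (hΔΘ : Δ ≤ Θ) (hδ : 0 < δ) (hδ2 : δ ≤ 1 / 2) :
    ∃ (lam : ℝ) (M n₀ : ℕ) (δ' er ef : ℝ), 0 < lam ∧ 0 < M ∧ 0 < δ' ∧ δ' < 1 ∧ 0 < er ∧ 0 < ef ∧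
      (∀ n : ℕ, 2 ^ n * lam ^ d ≤ (n + lam * d) ^ d → n ≤ n₀) ∧
      Real.sqrt lam * Θ + (H * er + ef) * Real.sqrt n₀ + ef < Δ / 2 ∧
      2 * A * Real.exp (-(M * (ef ^ 2 / (2 * Θ ^ 2)))) ≤ δ' ∧
      2 * Real.exp (-(M * (2 * er ^ 2))) ≤ δ' ∧
      1 - δ ≤ (1 - δ') ^ estimateBound A H n₀ ∧
      (H : ℝ) * (estimateBound A H n₀ * M) ≤
        10 ^ 9 * Real.log (2 + H + d + A + Θ + 1 / Δ + Real.log (1 / δ)) ^ 3 *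
          ((H : ℝ) ^ 5 * Θ ^ 5 * (d : ℝ) ^ 2 * (A : ℝ) ^ 2 * (1 / Δ) ^ 5 * Real.log (1 / δ)) := by
  have hA1 : (1 : ℝ) ≤ A := by exact_mod_cast hA
  have hH1 : (1 : ℝ) ≤ H := by exact_mod_cast hH
  have hd1 : (1 : ℝ) ≤ d := by exact_mod_cast hd
  have hΘ0 : 0 < Θ := by linarith
  set ℓ := Real.log (1 / δ) with hℓ
  have hℓ2 : 1 / 2 ≤ ℓ := by
    have h1 : Real.log 2 ≤ ℓ := Real.log_le_log (by norm_num) (by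
      rw [le_div_iff₀ hδ]
      linarith)
    linarith [Real.log_two_gt_d9]
  have hΔi : 0 < 1 / Δ := by positivity
  set X := 2 + H + d + A + Θ + 1 / Δ + ℓ with hX
  set L := Real.log X with hL
  have hX6 : 6 ≤ X := by linarith
  have hX0 : 0 < X := by linarith
  have hexpL : Real.exp L = X := Real.exp_log hX0
  have hL1 : 1 ≤ L := by
    rw [hL, Real.le_log_iff_exp_le hX0]
    linarith [Real.exp_one_lt_d9]
  have hLX : L ≤ X := (Real.log_le_sub_one_of_pos hX0).trans (by linarith)
  clear_value L X ℓ
  set R := Θ / Δ with hR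
  clear_value R
  have hR1 : 1 ≤ R := by rwa [hR, le_div_iff₀ hΔ, one_mul]
  have hRX : R ≤ X ^ 2 := by
    calc R = Θ * (1 / Δ) := by rw [hR]; ring
      _ ≤ X * X := by gcongr <;> linarith
      _ = X ^ 2 := by ring
  -- Chosen so that the bias `√λ Θ` equals `Δ / 8`.
  set lam := (Δ / (8 * Θ)) ^ 2 with hlam
  clear_value lam
  have hlam0 : 0 < lam := by rw [hlam]; positivity
  have hlam1 : lam ≤ 1 := by
    rw [hlam]
    refine pow_le_one₀ (by positivity) ?_
    rw [div_le_one (by positivity)]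
    linarith
  have hlog : Real.log (4 * d / lam) ≤ 13 * L := by
    refine log_le_mul_of_le_exp_pow (by positivity) (k := 13) ?_
    rw [hexpL]
    calc 4 * d / lam = 2 ^ 8 * d * R ^ 2 := by
          rw [hlam, hR]
          field_simp
          norm_num
      _ ≤ X ^ 8 * X * (X ^ 2) ^ 2 := by
          gcongr
          · linarith
          · linarith
      _ = X ^ 13 := by ring
  set n₀ := ⌈4 * (d * Real.log (4 * d / lam))⌉₊ + 1 with hn₀
  clear_value n₀
  have hn₀pos : 0 < n₀ := hn₀ ▸ Nat.succ_pos _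
  have hn₀1 : (1 : ℝ) ≤ n₀ := by exact_mod_cast hn₀pos
  have hlogn : 0 ≤ Real.log (4 * d / lam) := by
    apply Real.log_nonneg
    rw [le_div_iff₀ hlam0]
    linarith
  have hdL : 1 ≤ (d : ℝ) * L := one_le_mul_of_one_le_of_one_le hd1 hL1
  have hn₀le : (n₀ : ℝ) ≤ 54 * (d * L) := by
    have h1 := (Nat.ceil_lt_add_one (a := 4 * (d * Real.log (4 * d / lam))) (by positivity)).le
    have h2 : (d : ℝ) * Real.log (4 * d / lam) ≤ d * (13 * L) := by gcongr
    rw [hn₀]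
    push_cast
    linarith
  set K := estimateBound A H n₀ with hK
  have hKle : (K : ℝ) ≤ 6 * (H ^ 2 * A ^ 2 * n₀) := by exact_mod_cast estimateBound_le hA hH hn₀pos
  have hK1 : (1 : ℝ) ≤ K := by
    have : 1 ≤ K := hK ▸ le_trans (by omega : 1 ≤ H) (Nat.le_add_right _ _)
    exact_mod_cast this
  clear_value K
  -- Neither `n₀` nor `K` depends on `M`, so the failure probability per estimate can be fixed
  -- before the batch size.
  set δ' := δ / K with hδ'
  clear_value δ'
  have hδ'0 : 0 < δ' := by rw [hδ']; positivity
  have hδ'1 : δ' ≤ δ := hδ' ▸ div_le_self hδ.le hK1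
  have hsq : 0 < Real.sqrt n₀ := Real.sqrt_pos.2 (by linarith)
  have hsq2 : Real.sqrt n₀ ^ 2 = n₀ := Real.sq_sqrt (by linarith)
  have hsq1 : 1 ≤ Real.sqrt n₀ := Real.one_le_sqrt.2 hn₀1
  set Λ := Real.log (2 * A / δ') with hΛ
  have hΛ0 : 0 ≤ Λ := by
    apply Real.log_nonneg
    rw [le_div_iff₀ hδ'0]
    linarith
  -- The constant comes from `Λ ≤ 17 L + ℓ` together with `L ≤ 2 L ℓ` and `ℓ ≤ L ℓ`.
  have hΛle : Λ ≤ 35 * (L * ℓ) := by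
    have h1 : Λ = Real.log (2 * A * K) + ℓ := by
      rw [hΛ, hδ', hℓ, ← Real.log_mul (by positivity) (by positivity)]
      congr 1
      field_simp
    have h2 : Real.log (2 * A * K) ≤ (17 : ℕ) * L := by
      refine log_le_mul_of_le_exp_pow (by positivity) ?_
      rw [hexpL]
      calc 2 * A * K ≤ 2 * A * (6 * (H ^ 2 * A ^ 2 * (54 * (d * L)))) := by
            gcongr
            exact hKle.trans (by gcongr)
        _ = 648 * A ^ 3 * H ^ 2 * d * L := by ring
        _ ≤ 2 ^ 10 * X ^ 3 * X ^ 2 * X * X := by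
            gcongr
            · norm_num
            · linarith
            · linarith
            · linarith
        _ ≤ X ^ 10 * X ^ 3 * X ^ 2 * X * X := by
            gcongr
            linarith
        _ = X ^ 17 := by ring
    have h3 : L * (1 / 2) ≤ L * ℓ := by gcongr
    have h4 : 1 * ℓ ≤ L * ℓ := by gcongr
    push_cast at h2
    linarith
  set T := 512 * (H ^ 2 + Θ ^ 2) * n₀ * Λ / Δ ^ 2 with hT
  clear_value Λ T
  have hT0 : 0 ≤ T := by rw [hT]; positivity
  set M := ⌈T⌉₊ + 1 with hM
  clear_value M
  have hMT : T ≤ M := by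
    rw [hM]
    push_cast
    linarith [Nat.le_ceil T]
  have hMT' : (M : ℝ) ≤ T + 2 := by
    rw [hM]
    push_cast
    linarith [Nat.ceil_lt_add_one hT0]
  have hacc := le_mul_sq_accuracy (by linarith : (0 : ℝ) < H) hΘ0 hΔ (by linarith : (0 : ℝ) < n₀)
    hΛ0 (hT ▸ hMT)
  have hexpΛ : Real.exp (-Λ) = δ' / (2 * A) := by
    rw [Real.exp_neg, hΛ, Real.exp_log (by positivity), inv_div]
  -- The accuracies make `(H er + ef) √n₀ = Δ / 8` and `ef ≤ Δ / 16`, so the total error is at most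
  -- `5 Δ / 16 < Δ / 2`.
  refine ⟨lam, M, n₀, δ', Δ / (16 * H * Real.sqrt n₀), Δ / (16 * Real.sqrt n₀), hlam0,
    hM ▸ Nat.succ_pos _, hδ'0, by linarith, by positivity, by positivity, fun n hn => ?_, ?_, ?_, ?_,
    ?_, ?_⟩
  · have h1 := le_of_two_pow_mul_le hd hlam0 hlam1 hn
    have h2 : (n : ℝ) ≤ (⌈4 * (d * Real.log (4 * d / lam))⌉₊ : ℕ) := h1.trans (Nat.le_ceil _)
    have h3 : n ≤ ⌈4 * (d * Real.log (4 * d / lam))⌉₊ := by exact_mod_cast h2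
    omega
  · have h1 : Real.sqrt lam = Δ / (8 * Θ) := by
      rw [hlam, Real.sqrt_sq (by positivity)]
    have h2 : Δ / (8 * Θ) * Θ = Δ / 8 := by field_simp
    have h3 : (H * (Δ / (16 * H * Real.sqrt n₀)) + Δ / (16 * Real.sqrt n₀)) * Real.sqrt n₀
        = Δ / 8 := by
      field_simp
      norm_num
    have h4 : Δ / (16 * Real.sqrt n₀) ≤ Δ / 16 := by
      gcongr
      linarith
    rw [h1, h2, h3]
    linarith
  · calc _ ≤ 2 * A * Real.exp (-Λ) := by
          gcongr
          exact hacc.1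
      _ = δ' := by rw [hexpΛ]; field_simp
  · calc _ ≤ 2 * A * Real.exp (-Λ) := by
          gcongr
          · linarith
          · exact hacc.2
      _ = δ' := by rw [hexpΛ]; field_simp
  · have h1 := one_add_mul_le_pow (a := -δ') (by linarith) K
    have h2 : (K : ℝ) * δ' = δ := by
      rw [hδ']
      field_simp
    rw [← hK, sub_eq_add_neg 1 δ']
    linarith
  · have hΘR : Θ ^ 5 * (1 / Δ) ^ 5 = R ^ 5 := by
      rw [← mul_pow, hR]
      congr 1
      ring
    rw [← hK]
    refine (sample_bound (d := d) (K := K) (M := M) (T := T) (Λ := Λ) hH1 hΘ hΔ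
      (hR ▸ hR1) hn₀1 hL1 hℓ2 hKle hn₀le hΛ0 hΛle hT (Nat.cast_nonneg M)
      hMT').trans (le_of_eq ?_)
    rw [← hR, ← hΘR]
    ring

end Parameters

/-! ## The sample complexity theorem -/

/-- The regression parameters of the optimal `Q`-function: a functional that is linear in `φ` is
linear in the mean embedding of the observations. -/
theorem exists_regression_parameter {A : Type*} {H d ds : ℕ} (hds : 0 < ds)
    (G : ℕ → Matrix (Fin d) (Fin ds) ℝ)
    (hG : ∀ h < H, ∃ Gd : Matrix (Fin ds) (Fin d) ℝ, Gd * G h = 1)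
    (w : A → ℕ → EuclideanSpace ℝ (Fin ds)) {W Θ : ℝ} (hw : ∀ h < H, ∀ a, ‖w a h‖ ≤ W)
    (hΘ1 : 1 ≤ Θ) (hΘ : Θ = W / ⨅ h : Fin H, smallestSingularValue (G h)) :
    ∃ θ : A → ℕ → EuclideanSpace ℝ (Fin d), ∀ a, ∀ h < H, ‖θ a h‖ ≤ Θ ∧
      ∀ v, inner ℝ (θ a h) (Matrix.toEuclideanLin (G h) v) = inner ℝ (w a h) v := by
  have key : ∀ a h, ∃ θ : EuclideanSpace ℝ (Fin d), h < H → ‖θ‖ ≤ Θ ∧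
      ∀ v, inner ℝ θ (Matrix.toEuclideanLin (G h) v) = inner ℝ (w a h) v := by
    intro a h
    by_cases hh : h < H
    · have hnn : ∀ k : Fin H, 0 ≤ smallestSingularValue (G k) := fun k =>
        LinearMap.singularValues_nonneg _ _
      -- A vanishing infimum would give `Θ = W / 0 = 0`, against `1 ≤ Θ`.
      have hη0 : 0 < ⨅ k : Fin H, smallestSingularValue (G k) := by
        refine lt_of_le_of_ne (Real.iInf_nonneg hnn) fun h0 => ?_
        rw [← h0, div_zero] at hΘ
        linarith
      have hle : ⨅ k : Fin H, smallestSingularValue (G k) ≤ smallestSingularValue (G h) :=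
        ciInf_le (Set.finite_range _).bddBelow (⟨h, hh⟩ : Fin H)
      obtain ⟨Gd, hGd⟩ := hG h hh
      obtain ⟨θ, hθ, hθ'⟩ := exists_inner_toEuclideanLin_eq hds (le_of_leftInverse hGd) (G h)
        (hη0.trans_le hle) (w a h)
      refine ⟨θ, fun _ => ⟨hθ.trans ?_, hθ'⟩⟩
      rw [hΘ]
      have hW := hw h hh a
      have hW0 : 0 ≤ W := (norm_nonneg _).trans hW
      gcongr
    · exact ⟨0, fun h => absurd h hh⟩
  choose θ hθ using key
  exact ⟨θ, fun a h hh => hθ a h hh⟩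

end EQDP

theorem mainTheorem1 :
    ∃ (C : ℝ) (m : ℕ), 0 < C ∧
    ∀ (A : Type*) [Fintype A] [Nonempty A] (H d : ℕ) (Θ Δ δ : ℝ),
      0 < H → 1 ≤ Θ → 0 < Δ → Δ ≤ Θ → 0 < δ → δ ≤ 1 / 2 →
    ∃ (lam : ℝ) (M : ℕ) (ε : ℝ), 0 < lam ∧ 0 < M ∧ 0 < ε ∧
    ∀ (S O : Type*) [MeasurableSpace S] [MeasurableSpace O] (P : EQDP.POMDP S A O)
      (ds : ℕ) (ψ : O → EuclideanSpace ℝ (Fin d)) (φ : S → EuclideanSpace ℝ (Fin ds))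
      (G : ℕ → Matrix (Fin d) (Fin ds) ℝ) (p : ℕ → S → A → S)
      (w : A → ℕ → EuclideanSpace ℝ (Fin ds)) (W : ℝ) (argmax : (A → ℝ) → A),
      0 < ds →
      -- the observation feature is measurable and bounded by one
      Measurable ψ → (∀ o, ‖ψ o‖ ≤ 1) →
      -- left-invertible linear conditional mean embedding
      (∀ h < H, ∃ Gd : Matrix (Fin ds) (Fin d) ℝ, Gd * G h = 1) →
      (∀ h < H, ∀ s, ∫ o, ψ o ∂(P.emit h s) = Matrix.toEuclideanLin (G h) (φ s)) →
      -- deterministic latent transitions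
      (∀ h < H, ∀ s a, P.trans h a s = MeasureTheory.Measure.dirac (p h s a)) →
      -- linear optimal Q-function
      (∀ h < H, ∀ s a, P.Qstar p H h s a = inner ℝ (w a h) (φ s)) →
      (∀ h < H, ∀ a, ‖w a h‖ ≤ W) →
      -- suboptimality gap
      (∀ h < H, ∀ s a, 0 < P.gap p H h s a → Δ ≤ P.gap p H h s a) →
      Θ = W / ⨅ h : Fin H, EQDP.smallestSingularValue (G h) →
      -- `argmax` selects a maximizer, ties being broken in any way
      (∀ (f : A → ℝ) (a : A), f a ≤ f (argmax f)) →
      ENNReal.ofReal (1 - δ) ≤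
        EQDP.successProb ⟨H, ψ, M, ε, lam, argmax⟩ P (fun l N =>
          P.IsOptimalSeq H l ∧
          (N : ℝ) ≤
            C * Real.log (2 + H + d + Fintype.card A + Θ + 1 / Δ + Real.log (1 / δ)) ^ m *
              ((H : ℝ) ^ 5 * Θ ^ 5 * (d : ℝ) ^ 2 * (Fintype.card A : ℝ) ^ 2 * (1 / Δ) ^ 5 *
                Real.log (1 / δ))) := by
  refine ⟨10 ^ 9, 3, by norm_num, ?_⟩
  intro A _ _ H d Θ Δ δ hH hΘ hΔ hΔΘ hδ hδ2
  rcases Nat.eq_zero_or_pos d with rfl | hd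
  -- The parameters are fixed before the POMDP is given. For `d = 0` any values do, since no matrix
  -- with `ds > 0` columns and no rows has a left inverse.
  · refine ⟨1, 1, 1, one_pos, one_pos, one_pos, ?_⟩
    intro S O _ _ P ds ψ φ G p w W argmax hds _ _ hG
    obtain ⟨Gd, hGd⟩ := hG 0 hH
    have := EQDP.le_of_leftInverse hGd
    omega
  obtain ⟨lam, M, n₀, δ', er, ef, hlam, hM, hδ', hδ'1, her, hef, hcard, hacc, hfailx, hfailr, hprob,
    hbound⟩ := EQDP.exists_parameters (A := Fintype.card A) Fintype.card_pos hH hd hΘ hΔ hΔΘ hδ hδ2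
  refine ⟨lam, M, 1, hlam, hM, one_pos, ?_⟩
  intro S O _ _ P ds ψ φ G p w W argmax hds hψ hψ1 hG hemb hp hQ hw hgap hΘW hargmax
  obtain ⟨θ, hθ⟩ := EQDP.exists_regression_parameter hds G hG w hw hΘ hΘW
  set c : EQDP.Params A O d := ⟨H, ψ, M, 1, lam, argmax⟩ with hc
  set st : List A → S := EQDP.POMDP.stateAt p 0 P.init with hst
  set s : ENNReal := (ENNReal.ofReal (1 - δ'))⁻¹ with hs
  have hδ'pos : 0 < ENNReal.ofReal (1 - δ') := ENNReal.ofReal_pos.2 (by linarith)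
  have hscale : ∀ x : ℝ, x ≤ δ' → 1 ≤ s * (1 - ENNReal.ofReal x) := by
    intro x hx
    calc (1 : ENNReal) = s * ENNReal.ofReal (1 - δ') :=
          (ENNReal.inv_mul_cancel hδ'pos.ne' ENNReal.ofReal_ne_top).symm
      _ = s * (1 - ENNReal.ofReal δ') := by rw [ENNReal.ofReal_sub _ hδ'.le, ENNReal.ofReal_one]
      _ ≤ _ := by gcongr
  have hmodel : EQDP.AccurateModel P c s
      (fun l => P.valueToGo p (H - l.length) l.length (st l))
      (fun l a => P.Qstar p H l.length (st l) a)
      (fun l a => P.meanReward l.length (st l) a) θ Δ Θ er ef n₀ := by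
    refine ⟨hlam, rfl, her.le, hef.le, hargmax, fun l a hl => ?_, fun l hl => ?_, fun l a hl => ?_,
      fun l hl => ?_, fun l hl => ?_, fun l a hl h0 => ?_, fun a h hh => (hθ a h hh).1, hcard, hacc⟩
    · have hlaw := EQDP.POMDP.rewLaw_eq (P := P) hp (le_of_lt hl) a
      have : MeasureTheory.IsProbabilityMeasure (P.rewLaw l a) := by
        rw [hlaw]
        infer_instance
      have := EQDP.ensures_estReward P c l a (by rw [hlaw]; exact P.rew_mem _ _ _) hM her
        (hscale _ hfailr)
      rwa [hlaw] at this
    · have hlaw := EQDP.POMDP.obsLaw_eq (P := P) hp (le_of_lt hl)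
      have : MeasureTheory.IsProbabilityMeasure (P.obsLaw l) := by
        rw [hlaw]
        infer_instance
      have := EQDP.ensures_estFeature P c l hψ hψ1 hM (fun a => θ a l.length) (by linarith) hef
        (fun a => (hθ a _ hl).1) (hscale _ hfailx)
      refine this.mono fun x j hx => ⟨hx.1, hx.2.1, fun a => ?_⟩
      have hmean : ∫ o, inner ℝ (θ a l.length) (c.ψ o) ∂(P.obsLaw l)
          = P.Qstar p H l.length (st l) a := by
        have hint : MeasureTheory.Integrable ψ (P.obsLaw l) :=
          MeasureTheory.Integrable.of_bound hψ.aestronglyMeasurable 1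
            (Filter.Eventually.of_forall hψ1)
        -- The expectation moves inside the inner product, and `⟨θ, G φ(s)⟩ = ⟨w, φ(s)⟩` is the
        -- optimal Q-value.
        rw [integral_inner hint, hlaw, hemb _ hl, (hθ a _ hl).2, hQ _ hl]
      rw [← hmean]
      exact hx.2.2 a
    · have hl' : l.length < H := hl
      simp only [EQDP.POMDP.Qstar, hl', if_true, List.length_append, List.length_singleton, hst,
        EQDP.POMDP.stateAt_append_singleton, zero_add]
    · exact (EQDP.POMDP.Vstar_eq (P := P) (p := p) hl (st l)).symm
    · have hl' : l.length = H := hl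
      simp only [hl', Nat.sub_self]
      rfl
    · rw [← EQDP.POMDP.Vstar_eq (P := P) (p := p) hl (st l)] at h0 ⊢
      exact hgap _ hl _ _ h0
  refine hmodel.le_successProb ?_ ?_ ?_
  · rw [hs, ENNReal.one_le_inv]
    exact ENNReal.ofReal_le_one.2 (by linarith)
  · calc ENNReal.ofReal (1 - δ) * s ^ EQDP.estimateBound (Fintype.card A) H n₀
        ≤ ENNReal.ofReal (1 - δ') ^ EQDP.estimateBound (Fintype.card A) H n₀
          * s ^ EQDP.estimateBound (Fintype.card A) H n₀ := by
          gcongr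
          rw [← ENNReal.ofReal_pow (by linarith)]
          exact ENNReal.ofReal_le_ofReal hprob
      _ = 1 := by
          rw [← mul_pow, hs, ENNReal.mul_inv_cancel hδ'pos.ne' ENNReal.ofReal_ne_top, one_pow]
  · intro l j hl hV hj
    refine ⟨EQDP.POMDP.isOptimalSeq_of_pathReward hp hl hV, le_trans ?_ hbound⟩
    have hj' : j ≤ EQDP.estimateBound (Fintype.card A) H n₀ := hj
    change ((H * (j * M) : ℕ) : ℝ) ≤ _
    push_cast
    gcongr
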